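/- Let $n\in\mathbb N$, let $\Omega_1,\Omega_2\subset\mathbb R^n$ be open, let $f$ be a homeomorphism of $\Omega_1$ onto $\Omega_2$ with $f\in BV_{\mathrm{loc}}(\Omega_1,\mathbb R^n)$ (every point of $\Omega_1$ lies in a ball $B\subset\Omega_1$ with $f\in BV(B,\mathbb R^n)$), and let $1\le q<\infty$, $q'=\frac{q}{q-1}$ ($q'=\infty$ if $q=1$). Let $D^af:\Omega_1\to\mathbb R^{n\times n}$ denote the density with respect to Lebesgue measure of the absolutely continuous part of the matrix-valued measure $Df$ (the distributional derivative of $f$), let $|D^af|$ be its Euclidean norm, and let $J_f=\det D^af$. Then the following are equivalent. (i) There is a nonnegative function $K^a\in L^{q'}(\Omega_2)$ such that $$\int_{f^{-1}(A)}|D^af(x)|\,dx\le\int_A K^a(y)\,dy\qquad\text{for all Borel sets }A\subset\Omega_2.$$ (ii) There is a function $L\in L^{q'}(\Omega_1)$ such that $$|D^af(x)|\le L(x)\,|J_f(x)|^{1/q}\qquad\text{for a.e. }x\in\Omega_1.$$ -/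

import Mathlib

open MeasureTheory Filter Topology
open scoped ENNReal ContDiff

/-- The integral `∫ φ dν` of a real function against a (finite) signed measure. -/
noncomputable def signedIntegral {α : Type*} [MeasurableSpace α]
    (ν : SignedMeasure α) (φ : α → ℝ) : ℝ :=
  (∫ x, φ x ∂ν.toJordanDecomposition.posPart) - ∫ x, φ x ∂ν.toJordanDecomposition.negPart

/-- On the open set `U`, the `i`-th distributional partial derivative of `u` is the signed
measure `ν`: `∫_U u ∂ᵢφ = -∫ φ dν` for every `φ ∈ C_c^∞(U)`. Only the restriction of `ν` to `U`
matters, and it is determined by `u`. -/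
def HasDistribPartialDeriv {n : ℕ} (U : Set (EuclideanSpace ℝ (Fin n)))
    (u : EuclideanSpace ℝ (Fin n) → ℝ) (i : Fin n)
    (ν : SignedMeasure (EuclideanSpace ℝ (Fin n))) : Prop :=
  ∀ φ : EuclideanSpace ℝ (Fin n) → ℝ, ContDiff ℝ ∞ φ → HasCompactSupport φ → tsupport φ ⊆ U →
    ∫ x in U, u x * fderiv ℝ φ x (EuclideanSpace.single i 1) = -signedIntegral ν φ

/-- `u ∈ BV(U)`: `u ∈ L¹(U)` and all distributional partial derivatives of `u` on `U` are
signed measures of finite total variation. -/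
def IsBV {n : ℕ} (U : Set (EuclideanSpace ℝ (Fin n)))
    (u : EuclideanSpace ℝ (Fin n) → ℝ) : Prop :=
  IntegrableOn u U ∧ ∀ i, ∃ ν, HasDistribPartialDeriv U u i ν

/-- `f ∈ BV_loc(Ω, ℝⁿ)`: every point of `Ω` lies in a ball `B ⊆ Ω` such that every component
of `f` belongs to `BV(B)`. -/
def IsBVLoc {n : ℕ} (Ω : Set (EuclideanSpace ℝ (Fin n)))
    (f : EuclideanSpace ℝ (Fin n) → EuclideanSpace ℝ (Fin n)) : Prop :=
  ∀ x ∈ Ω, ∃ c r, x ∈ Metric.ball c r ∧ Metric.ball c r ⊆ Ω ∧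
    ∀ j, IsBV (Metric.ball c r) (fun z => f z j)

open Classical in
/-- The measure `D_i u` on `U` (a signed measure whose restriction to `U` is the `i`-th
distributional partial derivative of `u` on `U`), or `0` if there is none. -/
noncomputable def distribPartialDeriv {n : ℕ} (U : Set (EuclideanSpace ℝ (Fin n)))
    (u : EuclideanSpace ℝ (Fin n) → ℝ) (i : Fin n) :
    SignedMeasure (EuclideanSpace ℝ (Fin n)) :=
  if h : ∃ ν, HasDistribPartialDeriv U u i ν then h.choose else 0

/-- The density `Dᵃf` of the absolutely continuous part of the matrix-valued measure `Df` with
respect to Lebesgue measure, as the Radon-Nikodym (Besicovitch) derivative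
`(Dᵃf(x))_{ji} = lim_{r → 0+} (D_i f_j)(B(x,r)) / |B(x,r)|`, a limit which exists for almost every
`x` in an open set on which `f` is locally of bounded variation. -/
noncomputable def acDeriv {n : ℕ}
    (f : EuclideanSpace ℝ (Fin n) → EuclideanSpace ℝ (Fin n)) (x : EuclideanSpace ℝ (Fin n)) :
    Matrix (Fin n) (Fin n) ℝ :=
  Matrix.of fun j i => limUnder (𝓝[>] (0 : ℝ)) fun r =>
    distribPartialDeriv (Metric.ball x r) (fun z => f z j) i (Metric.ball x r) /
      volume.real (Metric.ball x r)

/-- The Jacobian `J_f = det Dᵃf`. -/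
noncomputable def acJacobian {n : ℕ}
    (f : EuclideanSpace ℝ (Fin n) → EuclideanSpace ℝ (Fin n)) (x : EuclideanSpace ℝ (Fin n)) : ℝ :=
  (acDeriv f x).det

/-- The Euclidean (Frobenius) norm of a matrix. -/
noncomputable def matrixNorm {n : ℕ} (M : Matrix (Fin n) (Fin n) ℝ) : ℝ :=
  √(∑ j, ∑ i, M j i ^ 2)

/-!
Transporting `K` by `f` turns condition (i) into an inequality `|Dᵃf| dx ≤ K dν` of measures on
`Ω₁`, where `ν` is the pullback of Lebesgue measure under `f`. Since `|Dᵃf| dx` does not see the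
part of `ν` that is singular to Lebesgue measure, this says `|Dᵃf| ≤ J K` almost everywhere, `J`
being the density of the absolutely continuous part of `ν`. The substitution `L = J ^ (1 / q') * K`,
with inverse `K = |L| * J ^ (1 / q - 1)`, identifies the `L^{q'}` norms and turns the inequality
into `|Dᵃf| ≤ L J ^ (1 / q)`.

That `J = |J_f|` follows from the area formula, applied on countably many pieces which cover `Ω₁` up
to a null set and along which `f` is differentiable with derivative `Dᵃf`. The pieces are the sets
where the total variation of `Df` has bounded density at all small scales. If a continuous `v` has
distributional gradient of small density around `x` and of bounded density around `y`, then
comparing `v(x)` and `v(y)` with one average of `v` over a ball around `y` of radius `δ |y - x|`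
gives `|v(y) - v(x)| ≤ (C δ + C_δ ε) |y - x|`; take `v` to be a component of `f` minus its linear
part at `x`. The comparison of `v(x)` with an average is obtained by shrinking the averaging kernel
to `x`: the derivative of the average with respect to the scale is an integral against the gradient.
-/

section WithDensity

variable {X : Type*} [MeasurableSpace X] {μ ν : Measure X}

theorem exists_restrict_eq_withDensity_rnDeriv [ν.HaveLebesgueDecomposition μ] :
    ∃ G, MeasurableSet G ∧ μ Gᶜ = 0 ∧ ν.restrict G = μ.withDensity (ν.rnDeriv μ) := by
  have hsing := Measure.mutuallySingular_singularPart ν μ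
  refine ⟨hsing.nullSet, hsing.measurableSet_nullSet, hsing.measure_compl_nullSet, ?_⟩
  rw [congrArg (Measure.restrict · hsing.nullSet) (Measure.haveLebesgueDecomposition_add ν μ),
    Measure.restrict_add, hsing.restrict_nullSet, zero_add,
    restrict_withDensity hsing.measurableSet_nullSet,
    Measure.restrict_eq_self_of_ae_mem (s := hsing.nullSet) hsing.measure_compl_nullSet]

theorem withDensity_le_withDensity_iff_ae_le_rnDeriv_mul [SigmaFinite μ]
    [ν.HaveLebesgueDecomposition μ] {D K : X → ℝ≥0∞} (hD : AEMeasurable D μ)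
    (hK : AEMeasurable K ν) :
    μ.withDensity D ≤ ν.withDensity K ↔ D ≤ᵐ[μ] fun x => ν.rnDeriv μ x * K x := by
  obtain ⟨G, hG, hμG, hνG⟩ := exists_restrict_eq_withDensity_rnDeriv (μ := μ) (ν := ν)
  have hrn := (Measure.measurable_rnDeriv ν μ).aemeasurable (μ := μ)
  have setLIntegral_eq {A : Set X} (hA : MeasurableSet A) :
      ∫⁻ x in A, ν.rnDeriv μ x * K x ∂μ = ∫⁻ x in A ∩ G, K x ∂ν := by
    rw [← Measure.restrict_restrict hA, hνG, restrict_withDensity hA,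
      lintegral_withDensity_eq_lintegral_mul₀' hrn.restrict]
    · rfl
    · rw [← restrict_withDensity hA, ← hνG]
      exact hK.restrict.restrict
  constructor
  · intro hle
    refine ae_le_of_forall_setLIntegral_le_of_sigmaFinite₀ hD fun A hA _ => ?_
    calc ∫⁻ x in A, D x ∂μ
        = ∫⁻ x in A ∩ G, D x ∂μ := by
          rw [← Measure.restrict_restrict hA, Measure.restrict_eq_self_of_ae_mem (s := G) hμG]
      _ ≤ ∫⁻ x in A ∩ G, K x ∂ν := by
          rw [← withDensity_apply _ (hA.inter hG), ← withDensity_apply _ (hA.inter hG)]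
          exact hle _
      _ = ∫⁻ x in A, ν.rnDeriv μ x * K x ∂μ := (setLIntegral_eq hA).symm
  · intro hle
    refine (withDensity_mono hle).trans (Measure.le_iff.2 fun A hA => ?_)
    rw [withDensity_apply _ hA, withDensity_apply _ hA, setLIntegral_eq hA]
    exact lintegral_mono_set Set.inter_subset_left

theorem eLpNorm_withDensity_coe {J : X → NNReal} (hJ : Measurable J) (w : X → ℝ) {p : ℝ≥0∞}
    (hp : p ≠ 0) :
    eLpNorm w p (μ.withDensity fun x => J x) =
      eLpNorm (fun x => (J x : ℝ) ^ (p.toReal⁻¹ - 1) * (J x * w x)) p μ := by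
  rcases eq_or_ne p ⊤ with rfl | hptop
  · simp only [eLpNorm_exponent_top, eLpNormEssSup, essSup_eq_sInf]
    refine congrArg sInf (Set.ext fun a => ?_)
    rw [Set.mem_ofPred_eq, Set.mem_ofPred_eq, withDensity_apply_eq_zero hJ.coe_nnreal_ennreal]
    congr! 2
    ext x
    rcases eq_or_ne (J x) 0 with hx | hx
    · simp [hx]
    · simp [hx, Real.rpow_neg_one, -enorm_mul]
  · have hp0 : 0 < p.toReal := ENNReal.toReal_pos hp hptop
    rw [eLpNorm_eq_lintegral_rpow_enorm_toReal hp hptop,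
      eLpNorm_eq_lintegral_rpow_enorm_toReal hp hptop,
      lintegral_withDensity_eq_lintegral_mul_non_measurable₀ _ hJ.coe_nnreal_ennreal.aemeasurable
        (by simp)]
    congr! 3 with x
    by_cases hx : J x = 0
    · simp [hx, hp0]
    · have hJx : (0 : ℝ) < J x := by positivity
      have hpow : (J x : ℝ) ^ (p.toReal⁻¹ - 1) * (J x * w x) = (J x : ℝ) ^ p.toReal⁻¹ * w x := by
        rw [Real.rpow_sub_one hJx.ne']
        field_simp
      rw [hpow, enorm_mul, ENNReal.mul_rpow_of_nonneg _ _ hp0.le, Pi.mul_apply,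
        Real.enorm_of_nonneg (r := (J x : ℝ) ^ p.toReal⁻¹) (by positivity),
        ENNReal.ofReal_rpow_of_nonneg (by positivity) hp0.le,
        Real.rpow_inv_rpow hJx.le hp0.ne', ENNReal.ofReal_coe_nnreal]

theorem memLp_withDensity_coe_iff {J : X → NNReal} (hJ : Measurable J) {w : X → ℝ} {p : ℝ≥0∞}
    (hp : p ≠ 0) :
    MemLp w p (μ.withDensity fun x => J x) ↔ AEMeasurable (fun x => (J x : ℝ) * w x) μ ∧
      MemLp (fun x => (J x : ℝ) ^ (p.toReal⁻¹ - 1) * (J x * w x)) p μ := by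
  have hmeas := aemeasurable_withDensity_iff (μ := μ) hJ (g := w)
  simp only [smul_eq_mul] at hmeas
  rw [MemLp, MemLp, eLpNorm_withDensity_coe hJ w hp, aestronglyMeasurable_iff_aemeasurable,
    aestronglyMeasurable_iff_aemeasurable, hmeas]
  have hprod (h : AEMeasurable (fun x => (J x : ℝ) * w x) μ) :
      AEMeasurable (fun x => (J x : ℝ) ^ (p.toReal⁻¹ - 1) * (J x * w x)) μ :=
    (hJ.coe_nnreal_real.pow_const _).aemeasurable.mul h
  tauto

theorem toReal_inv_sub_one_of_holderConjugate (p : ℝ≥0∞) {q : ℝ} (hq : 0 < q)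
    [p.HolderConjugate (ENNReal.ofReal q)] : p.toReal⁻¹ - 1 = -(1 / q) := by
  have hsum := ENNReal.HolderConjugate.inv_add_inv_eq_one p (ENNReal.ofReal q)
  have hp : p⁻¹ ≠ ⊤ := ne_top_of_le_ne_top ENNReal.one_ne_top (hsum ▸ le_self_add)
  have hsum' := congrArg ENNReal.toReal hsum
  rw [ENNReal.toReal_add hp (by simpa), ENNReal.toReal_inv, ENNReal.toReal_inv,
    ENNReal.toReal_ofReal hq.le, ENNReal.toReal_one] at hsum'
  rw [one_div]
  linarith

theorem mul_mul_rpow_sub_one {J : ℝ} (hJ : J ≠ 0) (a s : ℝ) :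
    J * (a * J ^ (s - 1)) = a * J ^ s := by
  rw [mul_left_comm, Real.rpow_sub_one hJ, mul_div_cancel₀ _ hJ]

theorem memLp_withDensity_abs_mul_rpow {J : X → NNReal} (hJ : Measurable J) {L : X → ℝ} {p : ℝ≥0∞}
    (hL : MemLp L p μ) {q : ℝ} (hq : 0 < q) [p.HolderConjugate (ENNReal.ofReal q)] :
    MemLp (fun x => |L x| * (J x : ℝ) ^ (1 / q - 1)) p (μ.withDensity fun x => J x) := by
  rw [memLp_withDensity_coe_iff hJ (ENNReal.HolderConjugate.ne_zero p (ENNReal.ofReal q))]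
  have hmeas : AEMeasurable (fun x => (J x : ℝ) * (|L x| * (J x : ℝ) ^ (1 / q - 1))) μ :=
    hJ.coe_nnreal_real.aemeasurable.mul
      (hL.aemeasurable.abs.mul (hJ.coe_nnreal_real.pow_const _).aemeasurable)
  refine ⟨hmeas, hL.mono ((hJ.coe_nnreal_real.pow_const _).aemeasurable.mul
    hmeas).aestronglyMeasurable (.of_forall fun x => ?_)⟩
  rcases eq_or_ne (J x) 0 with hx | hx
  · simp [hx]
  · rw [mul_mul_rpow_sub_one (by positivity), toReal_inv_sub_one_of_holderConjugate p hq,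
      mul_left_comm, ← Real.rpow_add (by positivity)]
    simp

theorem withDensity_ofReal_le_withDensity_ofReal_iff [SigmaFinite μ]
    [ν.HaveLebesgueDecomposition μ] {J : X → NNReal}
    (hJν : (fun x => (J x : ℝ≥0∞)) =ᵐ[μ] ν.rnDeriv μ) {D K : X → ℝ} (hD : AEMeasurable D μ)
    (hK : AEMeasurable K ν) (hK0 : 0 ≤ K) :
    ((μ.withDensity fun x => ENNReal.ofReal (D x)) ≤
        ν.withDensity fun x => ENNReal.ofReal (K x)) ↔
      ∀ᵐ x ∂μ, D x ≤ J x * K x := by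
  rw [withDensity_le_withDensity_iff_ae_le_rnDeriv_mul hD.ennreal_ofReal hK.ennreal_ofReal]
  refine eventually_congr (hJν.mono fun x hx => ?_)
  dsimp only at hx ⊢
  rw [← hx, ← ENNReal.ofReal_coe_nnreal, ← ENNReal.ofReal_mul (by positivity),
    ENNReal.ofReal_le_ofReal_iff (mul_nonneg (by positivity) (hK0 x))]

theorem exists_memLp_withDensity_le_iff_of_measurable [SigmaFinite μ]
    [ν.HaveLebesgueDecomposition μ] {J : X → NNReal} (hJ : Measurable J)
    (hJν : (fun x => (J x : ℝ≥0∞)) =ᵐ[μ] ν.rnDeriv μ)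
    {D : X → ℝ} (hD : AEMeasurable D μ) {p : ℝ≥0∞} {q : ℝ} (hq : 0 < q)
    [p.HolderConjugate (ENNReal.ofReal q)] :
    (∃ K : X → ℝ, 0 ≤ K ∧ MemLp K p ν ∧ (μ.withDensity fun x => ENNReal.ofReal (D x)) ≤
        ν.withDensity fun x => ENNReal.ofReal (K x)) ↔
      ∃ L : X → ℝ, MemLp L p μ ∧ ∀ᵐ x ∂μ, D x ≤ L x * (J x : ℝ) ^ (1 / q) := by
  have hp : p ≠ 0 := ENNReal.HolderConjugate.ne_zero p (ENNReal.ofReal q)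
  obtain ⟨G, hG, hμG, hνG⟩ := exists_restrict_eq_withDensity_rnDeriv (μ := μ) (ν := ν)
  rw [← withDensity_congr_ae hJν] at hνG
  constructor
  · rintro ⟨K, hK0, hK, hle⟩
    have hDK := (withDensity_ofReal_le_withDensity_ofReal_iff hJν hD hK.aemeasurable hK0).1 hle
    have hL := ((memLp_withDensity_coe_iff hJ hp).1 (hνG ▸ hK.restrict G)).2
    refine ⟨_, hL, hDK.mono fun x hx => hx.trans_eq ?_⟩
    rcases eq_or_ne (J x) 0 with hJx | hJx
    · simp [hJx]
    · have hJx' : (0 : ℝ) < J x := by positivity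
      rw [toReal_inv_sub_one_of_holderConjugate p hq, mul_right_comm, ← Real.rpow_add hJx',
        neg_add_cancel, Real.rpow_zero, one_mul]
  · rintro ⟨L, hL, hle⟩
    -- The singular part of `ν` lives outside `G`, where the integrability of `K` is not controlled.
    let K : X → ℝ := fun x => |L x| * (J x : ℝ) ^ (1 / q - 1)
    have hK : MemLp (G.indicator K) p ν := by
      rw [memLp_indicator_iff_restrict hG, hνG]
      exact memLp_withDensity_abs_mul_rpow hJ hL hq
    have hK0 : 0 ≤ G.indicator K := Set.indicator_nonneg fun x _ => by positivity
    refine ⟨_, hK0, hK, ?_⟩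
    rw [withDensity_ofReal_le_withDensity_ofReal_iff hJν hD hK.aemeasurable hK0]
    filter_upwards [hle, show ∀ᵐ x ∂μ, x ∈ G from hμG] with x hx hxG
    rw [Set.indicator_of_mem hxG]
    rcases eq_or_ne (J x) 0 with hJx | hJx
    · simpa [hJx, hq.ne'] using hx
    · rw [mul_mul_rpow_sub_one (by positivity)]
      exact hx.trans (by gcongr; exact le_abs_self _)

theorem exists_memLp_withDensity_le_iff [SigmaFinite μ] [ν.HaveLebesgueDecomposition μ] {J : X → ℝ}
    (hJν : (fun x => ENNReal.ofReal |J x|) =ᵐ[μ] ν.rnDeriv μ) {D : X → ℝ}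
    (hD : AEMeasurable D μ) {p : ℝ≥0∞} {q : ℝ} (hq : 0 < q)
    [p.HolderConjugate (ENNReal.ofReal q)] :
    (∃ K : X → ℝ, 0 ≤ K ∧ MemLp K p ν ∧ (μ.withDensity fun x => ENNReal.ofReal (D x)) ≤
        ν.withDensity fun x => ENNReal.ofReal (K x)) ↔
      ∃ L : X → ℝ, MemLp L p μ ∧ ∀ᵐ x ∂μ, D x ≤ L x * |J x| ^ (1 / q) := by
  have hJ : ∀ᵐ x ∂μ, ((ν.rnDeriv μ x).toNNReal : ℝ) = |J x| := by
    filter_upwards [hJν] with x hx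
    rw [← hx, ENNReal.coe_toNNReal_eq_toReal, ENNReal.toReal_ofReal (abs_nonneg _)]
  have hJ' : (fun x => ((ν.rnDeriv μ x).toNNReal : ℝ≥0∞)) =ᵐ[μ] ν.rnDeriv μ := by
    filter_upwards [hJν] with x hx
    exact ENNReal.coe_toNNReal (hx ▸ ENNReal.ofReal_ne_top)
  rw [exists_memLp_withDensity_le_iff_of_measurable
    (Measure.measurable_rnDeriv ν μ).ennreal_toNNReal hJ' hD hq]
  refine exists_congr fun L => and_congr_right fun _ => eventually_congr ?_
  filter_upwards [hJ] with x hx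
  rw [hx]

end WithDensity

section PullbackMeasure

variable {X Y : Type*} [TopologicalSpace X] [MeasurableSpace X] [BorelSpace X]
  [TopologicalSpace Y] [MeasurableSpace Y] [BorelSpace Y]

/-- The pullback of the measure `m` under the homeomorphism `f : f.source → f.target`, that is
`A ↦ m (f (A ∩ f.source))`, as a measure on the whole space which vanishes outside `f.source`. -/
noncomputable def pullbackMeasure (f : OpenPartialHomeomorph X Y) (m : Measure Y) : Measure X :=
  (m.restrict f.target).map f.symm

instance (f : OpenPartialHomeomorph X Y) (m : Measure Y) [SFinite m] :
    SFinite (pullbackMeasure f m) :=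
  inferInstanceAs (SFinite ((m.restrict f.target).map f.symm))

theorem aemeasurable_symm_restrict_target (f : OpenPartialHomeomorph X Y) (m : Measure Y) :
    AEMeasurable f.symm (m.restrict f.target) :=
  f.continuousOn_symm.aemeasurable f.open_target.measurableSet

theorem measurableSet_source_inter_preimage (f : OpenPartialHomeomorph X Y) {A : Set Y}
    (hA : MeasurableSet A) : MeasurableSet (f.source ∩ f ⁻¹' A) := by
  have h := f.open_source.measurableSet.subtype_image (f.continuousOn.domRestrict.measurable hA)
  rwa [Set.domRestrict_eq, Set.preimage_comp, Subtype.image_preimage_coe] at h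

theorem setLIntegral_pullbackMeasure (f : OpenPartialHomeomorph X Y) (m : Measure Y)
    {g : X → ℝ≥0∞} (hg : AEMeasurable g (pullbackMeasure f m)) {B : Set X}
    (hB : MeasurableSet B) :
    ∫⁻ x in B, g x ∂pullbackMeasure f m = ∫⁻ y in f.target ∩ f.symm ⁻¹' B, g (f.symm y) ∂m := by
  have hsymm := aemeasurable_symm_restrict_target f m
  have hgB := hg.restrict (s := B)
  rw [pullbackMeasure, Measure.restrict_map_of_aemeasurable hsymm hB] at hgB ⊢
  rw [lintegral_map' hgB hsymm.restrict,
    Measure.restrict_restrict₀ (hsymm.nullMeasurable hB), Set.inter_comm]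

theorem pullbackMeasure_apply (f : OpenPartialHomeomorph X Y) (m : Measure Y) {B : Set X}
    (hB : MeasurableSet B) : pullbackMeasure f m B = m (f '' (f.source ∩ B)) := by
  rw [pullbackMeasure, Measure.map_apply_of_aemeasurable (aemeasurable_symm_restrict_target f m) hB,
    Measure.restrict_apply' f.open_target.measurableSet, Set.inter_comm, f.image_source_inter_eq']

theorem restrict_source_pullbackMeasure (f : OpenPartialHomeomorph X Y) (m : Measure Y) :
    (pullbackMeasure f m).restrict f.source = pullbackMeasure f m := by
  refine Measure.restrict_eq_self_of_ae_mem ?_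
  refine (ae_map_iff (aemeasurable_symm_restrict_target f m) f.open_source.measurableSet).2 ?_
  filter_upwards [ae_restrict_mem f.open_target.measurableSet] with y hy using f.map_target hy

theorem aemeasurable_pullbackMeasure (f : OpenPartialHomeomorph X Y) (m : Measure Y) :
    AEMeasurable f (pullbackMeasure f m) := by
  rw [← restrict_source_pullbackMeasure]
  exact f.continuousOn.aemeasurable f.open_source.measurableSet

theorem map_pullbackMeasure (f : OpenPartialHomeomorph X Y) (m : Measure Y) :
    (pullbackMeasure f m).map f = m.restrict f.target := by
  rw [pullbackMeasure, AEMeasurable.map_map_of_aemeasurable (aemeasurable_pullbackMeasure f m)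
    (aemeasurable_symm_restrict_target f m)]
  have hid : f ∘ f.symm =ᵐ[m.restrict f.target] id := by
    filter_upwards [ae_restrict_mem f.open_target.measurableSet] with y hy using f.right_inv hy
  rw [Measure.map_congr hid, Measure.map_id]

theorem exists_memLp_target_iff_exists_memLp_pullbackMeasure (f : OpenPartialHomeomorph X Y)
    (μ : Measure X) (m : Measure Y) (D : X → ℝ≥0∞) (p : ℝ≥0∞) :
    (∃ K : Y → ℝ, 0 ≤ K ∧ MemLp K p (m.restrict f.target) ∧
        ∀ A, MeasurableSet A → A ⊆ f.target →
          ∫⁻ x in f.source ∩ f ⁻¹' A, D x ∂μ ≤ ∫⁻ y in A, ENNReal.ofReal (K y) ∂m) ↔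
      ∃ K : X → ℝ, 0 ≤ K ∧ MemLp K p (pullbackMeasure f m) ∧
        (μ.restrict f.source).withDensity D ≤
          (pullbackMeasure f m).withDensity fun x => ENNReal.ofReal (K x) := by
  constructor
  · rintro ⟨K, hK0, hK, hle⟩
    rw [← map_pullbackMeasure] at hK
    have hKf := hK.comp_of_map (aemeasurable_pullbackMeasure f m)
    refine ⟨K ∘ f, fun x => hK0 _, hKf, Measure.le_iff.2 fun B hB => ?_⟩
    have hA : MeasurableSet (f.target ∩ f.symm ⁻¹' B) :=
      measurableSet_source_inter_preimage f.symm hB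
    have hsource : f.source ∩ f ⁻¹' (f.target ∩ f.symm ⁻¹' B) = B ∩ f.source := by
      rw [f.source_inter_preimage_target_inter, f.source_inter_preimage_inv_preimage,
        Set.inter_comm]
    rw [withDensity_apply _ hB, withDensity_apply _ hB, Measure.restrict_restrict hB, ← hsource,
      setLIntegral_pullbackMeasure f m hKf.aemeasurable.ennreal_ofReal hB]
    refine (hle _ hA Set.inter_subset_left).trans_eq (setLIntegral_congr_fun hA fun y hy => ?_)
    simp [f.right_inv hy.1]
  · rintro ⟨K, hK0, hK, hle⟩
    refine ⟨K ∘ f.symm, fun y => hK0 _,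
      hK.comp_of_map (aemeasurable_symm_restrict_target f m), fun A hA hAt => ?_⟩
    have hB := measurableSet_source_inter_preimage f hA
    have htarget : f.target ∩ f.symm ⁻¹' (f.source ∩ f ⁻¹' A) = A := by
      rw [← f.image_source_inter_eq', ← Set.inter_assoc, Set.inter_self, f.image_source_inter_eq',
        f.target_inter_inv_preimage_preimage, Set.inter_eq_right.2 hAt]
    have h := hle (f.source ∩ f ⁻¹' A)
    rwa [withDensity_apply _ hB, withDensity_apply _ hB, Measure.restrict_restrict hB,
      Set.inter_eq_left.2 Set.inter_subset_left,
      setLIntegral_pullbackMeasure f m hK.aemeasurable.ennreal_ofReal hB, htarget] at h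

end PullbackMeasure

section PiecewiseDifferentiable

variable {E F : Type*} [NormedAddCommGroup E] [NormedSpace ℝ E] [MeasurableSpace E]
  [NormedAddCommGroup F] [NormedSpace ℝ F]

/-- `f` is differentiable with derivative `f'` along each of countably many measurable pieces of
`Ω` that cover `Ω` up to a `μ`-null set. This is all that the area formula needs; no pointwise
differentiability of `f` on `Ω` is implied. -/
def HasPiecewiseFDerivOn (μ : Measure E) (f : E → F) (f' : E → E →L[ℝ] F) (Ω : Set E) : Prop :=
  ∃ 𝒮 : Set (Set E), 𝒮.Countable ∧
    (∀ S ∈ 𝒮, MeasurableSet S ∧ S ⊆ Ω ∧ ∀ x ∈ S, HasFDerivWithinAt f (f' x) S x) ∧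
    μ (Ω \ ⋃₀ 𝒮) = 0

theorem hasPiecewiseFDerivOn_of_forall_mem_isOpen [SecondCountableTopology E] {μ : Measure E}
    {f : E → F} {f' : E → E →L[ℝ] F} {Ω : Set E}
    (h : ∀ x ∈ Ω, ∃ U, IsOpen U ∧ x ∈ U ∧ U ⊆ Ω ∧ HasPiecewiseFDerivOn μ f f' U) :
    HasPiecewiseFDerivOn μ f f' Ω := by
  choose! U hU hxU hUΩ 𝒮 h𝒮c h𝒮 h𝒮μ using h
  obtain ⟨T, hTΩ, hTc, hΩT⟩ := TopologicalSpace.countable_cover_nhdsWithin fun x hx =>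
    mem_nhdsWithin_of_mem_nhds ((hU x hx).mem_nhds (hxU x hx))
  refine ⟨⋃ x ∈ T, 𝒮 x, hTc.biUnion fun x hx => h𝒮c x (hTΩ hx), ?_, ?_⟩
  · intro S hS
    obtain ⟨x, hxT, hSx⟩ := Set.mem_iUnion₂.1 hS
    obtain ⟨hSm, hSU, hSd⟩ := h𝒮 x (hTΩ hxT) S hSx
    exact ⟨hSm, hSU.trans (hUΩ x (hTΩ hxT)), hSd⟩
  · refine measure_mono_null (fun y hy => ?_)
      ((measure_biUnion_null_iff hTc).2 fun x hx => h𝒮μ x (hTΩ hx))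
    obtain ⟨x, hxT, hyU⟩ := Set.mem_iUnion₂.1 (hΩT hy.1)
    refine Set.mem_biUnion hxT ⟨hyU, fun hy' => hy.2 ?_⟩
    exact Set.sUnion_subset_sUnion (Set.subset_biUnion_of_mem hxT) hy'

variable [FiniteDimensional ℝ E] [BorelSpace E] {μ : Measure E} [μ.IsAddHaarMeasure]

theorem HasPiecewiseFDerivOn.aemeasurable {f : E → E} {f' : E → E →L[ℝ] E} {Ω : Set E}
    (h : HasPiecewiseFDerivOn μ f f' Ω) : AEMeasurable f' (μ.restrict Ω) := by
  obtain ⟨𝒮, h𝒮c, h𝒮, h𝒮μ⟩ := h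
  have := h𝒮c.to_subtype
  have hS (S : 𝒮) : AEMeasurable f' (μ.restrict S) :=
    aemeasurable_fderivWithin μ (h𝒮 S S.2).1 (h𝒮 S S.2).2.2
  have hU := aemeasurable_iUnion_iff.2 hS
  rw [← Set.sUnion_eq_iUnion] at hU
  exact hU.mono_measure (Measure.restrict_mono_ae (ae_le_set.2 h𝒮μ))

theorem HasPiecewiseFDerivOn.abs_det_ae_eq_rnDeriv_pullbackMeasure {f : OpenPartialHomeomorph E E}
    {f' : E → E →L[ℝ] E} (h : HasPiecewiseFDerivOn μ f f' f.source) :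
    (fun x => ENNReal.ofReal |(f' x).det|) =ᵐ[μ.restrict f.source]
      (pullbackMeasure f μ).rnDeriv (μ.restrict f.source) := by
  have hmeas : AEMeasurable (fun x => ENNReal.ofReal |(f' x).det|) (μ.restrict f.source) :=
    (ContinuousLinearMap.continuous_det.measurable.comp_aemeasurable
      h.aemeasurable).abs.ennreal_ofReal
  obtain ⟨𝒮, h𝒮c, h𝒮, h𝒮μ⟩ := h
  have hU : MeasurableSet (⋃₀ 𝒮) := .sUnion h𝒮c fun S hS => (h𝒮 S hS).1
  have hμU : μ.restrict f.source (⋃₀ 𝒮)ᶜ = 0 := by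
    rwa [Measure.restrict_apply hU.compl, Set.inter_comm, ← Set.sdiff_eq]
  have harea : (pullbackMeasure f μ).restrict (⋃₀ 𝒮) =
      (μ.restrict f.source).withDensity fun x => ENNReal.ofReal |(f' x).det| := by
    rw [← Measure.restrict_eq_self_of_ae_mem (s := ⋃₀ 𝒮)
      (withDensity_absolutelyContinuous _ _ hμU), Measure.restrict_sUnion_congr h𝒮c]
    intro S hS
    obtain ⟨hSm, hSsub, hSd⟩ := h𝒮 S hS
    ext B hB
    have hBS : B ∩ S ⊆ f.source := Set.inter_subset_right.trans hSsub
    rw [Measure.restrict_apply hB, Measure.restrict_apply hB,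
      pullbackMeasure_apply f μ (hB.inter hSm), withDensity_apply _ (hB.inter hSm),
      Measure.restrict_restrict (hB.inter hSm), Set.inter_eq_left.2 hBS, Set.inter_eq_right.2 hBS,
      lintegral_abs_det_fderiv_eq_addHaar_image μ (hB.inter hSm)
        (fun x hx => (hSd x hx.2).mono Set.inter_subset_right) (f.injOn.mono hBS)]
  refine Measure.eq_rnDeriv₀ hmeas (s := (pullbackMeasure f μ).restrict (⋃₀ 𝒮)ᶜ)
    ⟨⋃₀ 𝒮, hU, by simp [Measure.restrict_apply hU], hμU⟩ ?_
  rw [← harea, Measure.restrict_compl_add_restrict hU]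

end PiecewiseDifferentiable

section Density

theorem abs_integral_le_of_support_subset {X : Type*} [MeasurableSpace X] {p : Measure X}
    {s : Set X} (hs : p s < ⊤) {φ : X → ℝ} {c : ℝ} (hc : ∀ z, |φ z| ≤ c)
    (hφs : Function.support φ ⊆ s) : |∫ z, φ z ∂p| ≤ c * p.real s := by
  rw [← setIntegral_eq_integral_of_forall_compl_eq_zero
    (fun z hz => Function.notMem_support.1 fun h => hz (hφs h)), ← Real.norm_eq_abs]
  exact norm_setIntegral_le_of_norm_le_const hs fun z _ => hc z

theorem abs_signedIntegral_le_of_support_subset {X : Type*} [MeasurableSpace X]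
    (ν : SignedMeasure X) {s : Set X} {φ : X → ℝ} {c : ℝ} (hc : ∀ z, |φ z| ≤ c)
    (hφs : Function.support φ ⊆ s) : |signedIntegral ν φ| ≤ c * ν.totalVariation.real s := by
  rw [SignedMeasure.totalVariation, measureReal_add_apply, mul_add]
  exact (abs_sub _ _).trans (add_le_add
    (abs_integral_le_of_support_subset (measure_lt_top _ _) hc hφs)
    (abs_integral_le_of_support_subset (measure_lt_top _ _) hc hφs))

theorem integral_eq_integral_singularPart_add {X : Type*} [MeasurableSpace X] {p μ : Measure X}
    [SigmaFinite p] [p.HaveLebesgueDecomposition μ] {φ : X → ℝ} (hφ : Integrable φ p) :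
    ∫ z, φ z ∂p = ∫ z, φ z ∂p.singularPart μ + ∫ z, (p.rnDeriv μ z).toReal * φ z ∂μ := by
  have hφ' := hφ
  rw [Measure.haveLebesgueDecomposition_add p μ, integrable_add_measure] at hφ'
  conv_lhs => rw [Measure.haveLebesgueDecomposition_add p μ]
  rw [integral_add_measure hφ'.1 hφ'.2, integral_withDensity_eq_integral_toReal_smul
    (Measure.measurable_rnDeriv _ _) (Measure.rnDeriv_lt_top p μ)]
  rfl

theorem abs_integral_sub_mul_integral_le {X : Type*} [MeasurableSpace X] {p μ : Measure X}
    [IsFiniteMeasure p] [SigmaFinite μ] {s : Set X} (hs : μ s < ⊤) {φ : X → ℝ} {c : ℝ}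
    (hφ : Measurable φ) (hc : ∀ z, |φ z| ≤ c) (hφs : Function.support φ ⊆ s) (g : ℝ) :
    |∫ z, φ z ∂p - g * ∫ z, φ z ∂μ| ≤
      c * (p.singularPart μ s + ∫⁻ z in s, ‖(p.rnDeriv μ z).toReal - g‖ₑ ∂μ).toReal := by
  set k : X → ℝ := fun z => (p.rnDeriv μ z).toReal
  have hk : Integrable k μ := Measure.integrable_toReal_rnDeriv
  have hks : IntegrableOn (fun z => k z - g) s μ :=
    hk.integrableOn.sub (integrableOn_const hs.ne)
  have hφp : Integrable φ p := .of_bound hφ.aestronglyMeasurable c (.of_forall hc)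
  have hφμ : Integrable φ μ := (integrableOn_iff_integrable_of_support_subset hφs).1
    (Measure.integrableOn_of_bounded hs.ne hφ.aestronglyMeasurable (.of_forall hc))
  have hkφ : Integrable (fun z => k z * φ z) μ :=
    hk.mul_bdd hφ.aestronglyMeasurable (.of_forall hc)
  have hsing := abs_integral_le_of_support_subset (measure_lt_top (p.singularPart μ) s) hc hφs
  have hac : |∫ z, k z * φ z ∂μ - g * ∫ z, φ z ∂μ| ≤ c * (∫⁻ z in s, ‖k z - g‖ₑ ∂μ).toReal := by
    have hzero : ∀ z ∉ s, k z * φ z - g * φ z = 0 := fun z hz => by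
      rw [Function.notMem_support.1 fun h => hz (hφs h), mul_zero, mul_zero, sub_zero]
    rw [← integral_const_mul, ← integral_sub hkφ (hφμ.const_mul _),
      ← integral_norm_eq_lintegral_enorm hks.aestronglyMeasurable, ← integral_const_mul,
      ← setIntegral_eq_integral_of_forall_compl_eq_zero hzero, ← Real.norm_eq_abs]
    refine norm_integral_le_of_norm_le (hks.norm.const_mul c) (.of_forall fun z => ?_)
    rw [← sub_mul, norm_mul, mul_comm]
    gcongr
    exact hc z
  rw [integral_eq_integral_singularPart_add hφp (μ := μ), add_sub_assoc,
    ENNReal.toReal_add (measure_ne_top _ _) hks.hasFiniteIntegral.ne, mul_add]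
  exact (abs_add_le _ _).trans (add_le_add hsing hac)

variable {X : Type*} [MetricSpace X] [MeasurableSpace X]

/-- At `x`, the functional `I` (an integral against a measure or a signed measure) has density `g`
with respect to `μ`: on test functions supported in a small ball around `x` it agrees with
`φ ↦ g * ∫ φ dμ` up to an error which is small compared to the measure of that ball. -/
def HasDensityAt (I : (X → ℝ) → ℝ) (μ : Measure X) (x : X) (g : ℝ) : Prop :=
  ∀ ε > 0, ∀ᶠ ρ in 𝓝[>] (0 : ℝ), ∀ (φ : X → ℝ) (c : ℝ), Measurable φ → (∀ z, |φ z| ≤ c) →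
    Function.support φ ⊆ Metric.closedBall x ρ →
      |I φ - g * ∫ z, φ z ∂μ| ≤ c * ε * μ.real (Metric.closedBall x ρ)

theorem HasDensityAt.sub {I I' : (X → ℝ) → ℝ} {μ : Measure X} {x : X} {g g' : ℝ}
    (h : HasDensityAt I μ x g) (h' : HasDensityAt I' μ x g') :
    HasDensityAt (fun φ => I φ - I' φ) μ x (g - g') := by
  intro ε hε
  filter_upwards [h (ε / 2) (half_pos hε), h' (ε / 2) (half_pos hε)] with ρ hρ hρ' φ c hφ hc hφρ
  calc |I φ - I' φ - (g - g') * ∫ z, φ z ∂μ|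
      = |(I φ - g * ∫ z, φ z ∂μ) - (I' φ - g' * ∫ z, φ z ∂μ)| := by ring_nf
    _ ≤ c * (ε / 2) * μ.real (Metric.closedBall x ρ) +
          c * (ε / 2) * μ.real (Metric.closedBall x ρ) :=
        (abs_sub _ _).trans (add_le_add (hρ φ c hφ hc hφρ) (hρ' φ c hφ hc hφρ))
    _ = c * ε * μ.real (Metric.closedBall x ρ) := by ring

variable [BorelSpace X] [SecondCountableTopology X] [HasBesicovitchCovering X] (μ : Measure X)
  [IsLocallyFiniteMeasure μ]

theorem ae_hasDensityAt_integral (p : Measure X) [IsFiniteMeasure p] :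
    ∀ᵐ x ∂μ, HasDensityAt (fun φ => ∫ z, φ z ∂p) μ x (p.rnDeriv μ x).toReal := by
  have hk : Integrable (fun z => (p.rnDeriv μ z).toReal) μ := Measure.integrable_toReal_rnDeriv
  filter_upwards [(Besicovitch.vitaliFamily μ).ae_eventually_measure_zero_of_singular
      (Measure.mutuallySingular_singularPart p μ),
    (Besicovitch.vitaliFamily μ).ae_tendsto_lintegral_enorm_sub_div hk.locallyIntegrable]
    with x hsing hac ε hε
  have herror := (hsing.add hac).comp (Besicovitch.tendsto_filterAt μ x)
  rw [add_zero] at herror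
  filter_upwards [herror.eventually_le_const (ENNReal.ofReal_pos.2 hε),
    (Besicovitch.tendsto_filterAt μ x).eventually
      ((Besicovitch.vitaliFamily μ).eventually_measure_lt_top x)] with ρ hρ hfin φ c hφ hc hφρ
  refine (abs_integral_sub_mul_integral_le hfin hφ hc hφρ _).trans ?_
  have hc0 : 0 ≤ c := (abs_nonneg _).trans (hc x)
  rw [Function.comp_apply, ← ENNReal.add_div, ENNReal.div_le_iff_le_mul
    (.inr ENNReal.ofReal_ne_top) (.inr (ENNReal.ofReal_pos.2 hε).ne')] at hρ
  have hρ' := ENNReal.toReal_mono (by finiteness) hρ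
  rw [ENNReal.toReal_mul, ENNReal.toReal_ofReal hε.le] at hρ'
  rw [mul_assoc]
  exact mul_le_mul_of_nonneg_left hρ' hc0

theorem ae_exists_hasDensityAt_signedIntegral (ν : SignedMeasure X) :
    ∀ᵐ x ∂μ, ∃ g, HasDensityAt (signedIntegral ν) μ x g := by
  filter_upwards [ae_hasDensityAt_integral μ ν.toJordanDecomposition.posPart,
    ae_hasDensityAt_integral μ ν.toJordanDecomposition.negPart] with x hpos hneg
  exact ⟨_, hpos.sub hneg⟩

theorem signedIntegral_indicator_one {X : Type*} [MeasurableSpace X] (ν : SignedMeasure X)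
    {s : Set X} (hs : MeasurableSet s) : signedIntegral ν (s.indicator 1) = ν s := by
  rw [signedIntegral, integral_indicator_one hs, integral_indicator_one hs,
    ν.apply_eq_posPart_real_sub_negPart_real hs]

theorem HasDensityAt.tendsto_apply_ball_div {E : Type*} [NormedAddCommGroup E] [NormedSpace ℝ E]
    [FiniteDimensional ℝ E] [MeasurableSpace E] [BorelSpace E] {μ : Measure E}
    [μ.IsAddHaarMeasure] {ν : SignedMeasure E} {x : E} {g : ℝ}
    (h : HasDensityAt (signedIntegral ν) μ x g) :
    Tendsto (fun r => ν (Metric.ball x r) / μ.real (Metric.ball x r)) (𝓝[>] 0) (𝓝 g) := by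
  refine Metric.tendsto_nhds.2 fun ε hε => ?_
  filter_upwards [h (ε / 2) (half_pos hε), self_mem_nhdsWithin] with r hr hr0
  have hpos : 0 < μ.real (Metric.ball x r) :=
    ENNReal.toReal_pos (Metric.measure_ball_pos μ x hr0).ne' measure_ball_lt_top.ne
  have hclosed : μ.real (Metric.closedBall x r) = μ.real (Metric.ball x r) := by
    rw [measureReal_def, measureReal_def, Measure.addHaar_closedBall μ x hr0.le,
      Measure.addHaar_ball_of_pos μ x hr0]
  have hone : ∀ z, |(Metric.ball x r).indicator (1 : E → ℝ) z| ≤ 1 := fun z =>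
    (norm_indicator_le_norm_self (1 : E → ℝ) z).trans_eq (by simp)
  have hball := hr _ 1 (measurable_one.indicator measurableSet_ball) hone
    (Set.support_indicator_subset.trans Metric.ball_subset_closedBall)
  rw [signedIntegral_indicator_one ν measurableSet_ball, integral_indicator_one measurableSet_ball,
    hclosed, one_mul] at hball
  rw [Real.dist_eq, div_sub' hpos.ne', abs_div, abs_of_pos hpos, div_lt_iff₀ hpos, mul_comm _ g]
  exact hball.trans_lt (by gcongr; exact half_lt_self hε)

end Density

section DensityBoundedSet

variable {E : Type*} [NormedAddCommGroup E] [MeasurableSpace E]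

/-- The points `x` at which the mass of `σ` in every ball of radius at most `1 / (m + 1)` is at
most `m` times the `μ`-measure of the ball. For a locally finite `σ` these sets exhaust the space
up to a `μ`-null set. -/
def densityBoundedSet (σ μ : Measure E) (m : ℕ) : Set E :=
  {x | ∀ ρ ∈ Set.Ioc (0 : ℝ) (1 / (m + 1)),
    σ (Metric.ball x ρ) ≤ m * μ (Metric.closedBall x ρ)}

theorem isClosed_setOf_measure_ball_le {X : Type*} [PseudoMetricSpace X] [MeasurableSpace X]
    (σ : Measure X) (ρ : ℝ) (c : ℝ≥0∞) : IsClosed {x | σ (Metric.ball x ρ) ≤ c} := by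
  refine isClosed_of_closure_subset fun x hx => ?_
  obtain ⟨r, hr, hrρ, hlim⟩ := exists_seq_strictMono_tendsto ρ
  have hunion : ⋃ k, Metric.ball x (r k) = Metric.ball x ρ := by
    ext z
    simpa only [Set.mem_iUnion, Metric.mem_ball] using
      ⟨fun ⟨k, hk⟩ => hk.trans (hrρ k), fun hz => (hlim.eventually_const_lt hz).exists⟩
  have hmono : Monotone fun k => Metric.ball x (r k) :=
    fun _ _ hkl => Metric.ball_subset_ball (hr.monotone hkl)
  rw [Set.mem_ofPred_eq, ← hunion, hmono.measure_iUnion]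
  refine iSup_le fun k => ?_
  obtain ⟨y, hy, hxy⟩ := Metric.mem_closure_iff.1 hx (ρ - r k) (sub_pos.2 (hrρ k))
  exact (measure_mono (Metric.ball_subset_ball' (by linarith))).trans hy

theorem isClosed_densityBoundedSet [BorelSpace E] (σ μ : Measure E) [μ.IsAddHaarMeasure] (m : ℕ) :
    IsClosed (densityBoundedSet σ μ m) := by
  simp only [densityBoundedSet, Measure.addHaar_closedBall_center μ, Set.ofPred_forall]
  exact isClosed_iInter fun ρ => isClosed_iInter fun _ => isClosed_setOf_measure_ball_le σ ρ _

theorem ae_exists_mem_densityBoundedSet [BorelSpace E] [SecondCountableTopology E]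
    [HasBesicovitchCovering E] (σ μ : Measure E) [IsLocallyFiniteMeasure σ]
    [IsLocallyFiniteMeasure μ] : ∀ᵐ x ∂μ, ∃ m, x ∈ densityBoundedSet σ μ m := by
  filter_upwards [Besicovitch.ae_tendsto_rnDeriv σ μ, σ.rnDeriv_lt_top μ] with x hx hlt
  obtain ⟨a, ha⟩ := ENNReal.exists_nat_gt hlt.ne
  obtain ⟨R, hR, hRa⟩ := mem_nhdsGT_iff_exists_Ioc_subset.1 (hx.eventually_le_const ha)
  obtain ⟨b, hb⟩ := exists_nat_one_div_lt (Set.mem_Ioi.1 hR)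
  refine ⟨max a b, fun ρ hρ => (measure_mono Metric.ball_subset_closedBall).trans ?_⟩
  have hbR : 1 / ((max a b : ℕ) + 1 : ℝ) ≤ R :=
    (Nat.one_div_le_one_div (le_max_right a b)).trans hb.le
  have hρa : σ (Metric.closedBall x ρ) / μ (Metric.closedBall x ρ) ≤ a :=
    hRa ⟨hρ.1, hρ.2.trans hbR⟩
  calc σ (Metric.closedBall x ρ) ≤ a * μ (Metric.closedBall x ρ) :=
        (ENNReal.div_le_iff_le_mul (.inr (ENNReal.natCast_ne_top a)) (.inr ha.ne_bot)).1 hρa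
    _ ≤ (max a b : ℕ) * μ (Metric.closedBall x ρ) := by gcongr; exact le_max_left a b

end DensityBoundedSet

section DistribDeriv

theorem exists_seq_contDiff_tendsto_indicator_of_isOpen {E : Type*} [NormedAddCommGroup E]
    [NormedSpace ℝ E] [FiniteDimensional ℝ E] {U : Set E} (hU : IsOpen U) :
    ∃ φ : ℕ → E → ℝ, (∀ k, ContDiff ℝ ∞ (φ k)) ∧ (∀ k, tsupport (φ k) ⊆ U) ∧
      (∀ k z, |φ k z| ≤ 1) ∧ ∀ z, Tendsto (fun k => φ k z) atTop (𝓝 (U.indicator 1 z)) := by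
  obtain ⟨f, hfU, hf, hf01⟩ := hU.exists_contDiff_support_eq (n := ⊤)
  have hf0 : ∀ z, 0 ≤ f z := fun z => (hf01 ⟨z, rfl⟩).1
  refine ⟨fun k z => Real.smoothTransition (k * f z - 1), fun k => ?_, fun k => ?_, fun k z => ?_,
    fun z => ?_⟩
  · exact Real.smoothTransition.contDiff.comp ((contDiff_const.mul hf).sub contDiff_const)
  · have hsub : tsupport (fun z => Real.smoothTransition (k * f z - 1)) ⊆ {z | 1 ≤ k * f z} :=
      closure_minimal (fun z hz => not_lt.1 fun hlt =>
        hz (Real.smoothTransition.zero_of_nonpos (sub_nonpos.2 hlt.le)))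
        (isClosed_le continuous_const (continuous_const.mul hf.continuous))
    refine fun z hz => hfU ▸ fun h0 => absurd (hsub hz) ?_
    simp [h0]
  · rw [abs_of_nonneg (Real.smoothTransition.nonneg _)]
    exact Real.smoothTransition.le_one _
  · by_cases hz : z ∈ U
    · have hpos : 0 < f z := (hf0 z).lt_of_ne' (by rwa [← hfU] at hz)
      rw [Set.indicator_of_mem hz]
      refine tendsto_const_nhds.congr' ?_
      filter_upwards [(tendsto_natCast_atTop_atTop.atTop_mul_const hpos).eventually_ge_atTop 2]
        with k hk
      exact (Real.smoothTransition.one_of_one_le (by linarith)).symm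
    · have h0 : f z = 0 := by rwa [← hfU, Function.notMem_support] at hz
      simp [h0, hz, Real.smoothTransition.zero_of_nonpos]

theorem tendsto_signedIntegral_of_tendsto_indicator {X : Type*} [MeasurableSpace X]
    (ν : SignedMeasure X) {s : Set X} (hs : MeasurableSet s) {φ : ℕ → X → ℝ}
    (hφ : ∀ k, Measurable (φ k)) (hc : ∀ k z, |φ k z| ≤ 1)
    (hlim : ∀ z, Tendsto (fun k => φ k z) atTop (𝓝 (s.indicator 1 z))) :
    Tendsto (fun k => signedIntegral ν (φ k)) atTop (𝓝 (ν s)) := by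
  have hp : ∀ (p : Measure X) [IsFiniteMeasure p],
      Tendsto (fun k => ∫ z, φ k z ∂p) atTop (𝓝 (∫ z, s.indicator 1 z ∂p)) := fun p _ =>
    tendsto_integral_of_dominated_convergence 1 (fun k => (hφ k).aestronglyMeasurable)
      (integrable_const 1) (fun k => .of_forall (hc k)) (.of_forall hlim)
  rw [← signedIntegral_indicator_one ν hs]
  exact (hp _).sub (hp _)

variable {n : ℕ} {U V : Set (EuclideanSpace ℝ (Fin n))} {u : EuclideanSpace ℝ (Fin n) → ℝ}
  {i : Fin n} {ν ν' : SignedMeasure (EuclideanSpace ℝ (Fin n))}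

theorem mul_fderiv_eq_zero_of_notMem {E : Type*} [NormedAddCommGroup E] [NormedSpace ℝ E]
    {U : Set E} {φ : E → ℝ} (hφU : tsupport φ ⊆ U) (u : E → ℝ) (w : E) :
    ∀ z ∉ U, u z * fderiv ℝ φ z w = 0 := fun z hz => by
  rw [fderiv_of_notMem_tsupport ℝ fun h => hz (hφU h), zero_apply, mul_zero]

theorem HasDistribPartialDeriv.mono (h : HasDistribPartialDeriv U u i ν) (hVU : V ⊆ U) :
    HasDistribPartialDeriv V u i ν := by
  intro φ hφ hφc hφV
  rw [← h φ hφ hφc (hφV.trans hVU),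
    setIntegral_eq_integral_of_forall_compl_eq_zero (mul_fderiv_eq_zero_of_notMem hφV u _),
    setIntegral_eq_integral_of_forall_compl_eq_zero
      (mul_fderiv_eq_zero_of_notMem (hφV.trans hVU) u _)]

theorem HasDistribPartialDeriv.apply_eq (h : HasDistribPartialDeriv U u i ν)
    (h' : HasDistribPartialDeriv U u i ν') (hU : IsOpen U) (hUb : Bornology.IsBounded U) :
    ν U = ν' U := by
  obtain ⟨φ, hφ, hφU, hφ1, hlim⟩ := exists_seq_contDiff_tendsto_indicator_of_isOpen hU
  have hφm : ∀ k, Measurable (φ k) := fun k => (hφ k).continuous.measurable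
  have hφc : ∀ k, HasCompactSupport (φ k) := fun k =>
    Metric.isCompact_of_isClosed_isBounded (isClosed_tsupport _) (hUb.subset (hφU k))
  refine tendsto_nhds_unique
    (tendsto_signedIntegral_of_tendsto_indicator ν hU.measurableSet hφm hφ1 hlim) ?_
  convert tendsto_signedIntegral_of_tendsto_indicator ν' hU.measurableSet hφm hφ1 hlim using 2
    with k
  exact neg_injective ((h _ (hφ k) (hφc k) (hφU k)).symm.trans (h' _ (hφ k) (hφc k) (hφU k)))

theorem hasDistribPartialDeriv_distribPartialDeriv (h : HasDistribPartialDeriv U u i ν) :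
    HasDistribPartialDeriv U u i (distribPartialDeriv U u i) := by
  have hex : ∃ ν, HasDistribPartialDeriv U u i ν := ⟨ν, h⟩
  rw [distribPartialDeriv, dif_pos hex]
  exact hex.choose_spec

theorem acDeriv_apply_eq_of_hasDensityAt
    {f : EuclideanSpace ℝ (Fin n) → EuclideanSpace ℝ (Fin n)} {j : Fin n} (hU : IsOpen U)
    (hν : HasDistribPartialDeriv U (fun z => f z j) i ν) {x : EuclideanSpace ℝ (Fin n)}
    (hx : x ∈ U) {g : ℝ} (hg : HasDensityAt (signedIntegral ν) volume x g) :
    acDeriv f x j i = g := by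
  refine (hg.tendsto_apply_ball_div.congr' ?_).limUnder_eq
  obtain ⟨R, hR, hRU⟩ := Metric.isOpen_iff.1 hU x hx
  filter_upwards [Ioc_mem_nhdsGT hR] with r hr
  have hνr := hν.mono ((Metric.ball_subset_ball hr.2).trans hRU)
  rw [hνr.apply_eq (hasDistribPartialDeriv_distribPartialDeriv hνr) Metric.isOpen_ball
    Metric.isBounded_ball]

theorem integral_clm_sub_mul_fderiv {E : Type*} [NormedAddCommGroup E] [NormedSpace ℝ E]
    [FiniteDimensional ℝ E] [MeasurableSpace E] [BorelSpace E] {μ : Measure E}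
    [μ.IsAddHaarMeasure] (ℓ : E →L[ℝ] ℝ) (x w : E) {φ : E → ℝ} (hφ : ContDiff ℝ 1 φ)
    (hφc : HasCompactSupport φ) :
    ∫ z, ℓ (z - x) * fderiv ℝ φ z w ∂μ = -(ℓ w * ∫ z, φ z ∂μ) := by
  have hfderiv : ∀ z, fderiv ℝ (fun z => ℓ (z - x)) z = ℓ := fun z => by
    simp only [map_sub, fderiv_sub_const, ℓ.fderiv]
  have hφi : Integrable φ μ := hφ.continuous.integrable_of_hasCompactSupport hφc
  rw [integral_mul_fderiv_eq_neg_fderiv_mul_of_integrable, ← integral_const_mul]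
  · simp_rw [hfderiv]
  · simpa only [hfderiv] using hφi.const_mul _
  · exact Continuous.integrable_of_hasCompactSupport
      (by have := hφ.continuous_fderiv one_ne_zero; fun_prop) (hφc.fderiv_apply ℝ w).mul_left
  · exact Continuous.integrable_of_hasCompactSupport (by fun_prop) hφc.mul_left
  · fun_prop
  · exact fun z _ => hφ.differentiable one_ne_zero z

theorem integrable_mul_fderiv {E : Type*} [NormedAddCommGroup E] [NormedSpace ℝ E]
    [MeasurableSpace E] [OpensMeasurableSpace E] {μ : Measure E} {v φ : E → ℝ}
    (hv : Integrable v μ) (hφ : ContDiff ℝ 1 φ) (hφc : HasCompactSupport φ) (w : E) :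
    Integrable (fun z => v z * fderiv ℝ φ z w) μ := by
  have hcont : Continuous fun z => fderiv ℝ φ z w :=
    (hφ.continuous_fderiv one_ne_zero).clm_apply continuous_const
  obtain ⟨C, hC⟩ := hcont.bounded_above_of_compact_support (hφc.fderiv_apply ℝ w)
  exact hv.mul_bdd hcont.aestronglyMeasurable (.of_forall hC)

theorem HasDistribPartialDeriv.integral_indicator_sub_clm_mul_fderiv
    (hν : HasDistribPartialDeriv U u i ν) (hU : MeasurableSet U) (hu : IntegrableOn u U)
    (ℓ : EuclideanSpace ℝ (Fin n) →L[ℝ] ℝ) (x : EuclideanSpace ℝ (Fin n))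
    {φ : EuclideanSpace ℝ (Fin n) → ℝ} (hφ : ContDiff ℝ ∞ φ) (hφc : HasCompactSupport φ)
    (hφU : tsupport φ ⊆ U) :
    ∫ z, U.indicator (fun z => u z - ℓ (z - x)) z * fderiv ℝ φ z (EuclideanSpace.single i 1) =
      -signedIntegral ν φ + ℓ (EuclideanSpace.single i 1) * ∫ z, φ z := by
  have hφ1 : ContDiff ℝ 1 φ := hφ.of_le (by exact_mod_cast le_top)
  have hℓ : Integrable fun z => ℓ (z - x) * fderiv ℝ φ z (EuclideanSpace.single i 1) :=
    Continuous.integrable_of_hasCompactSupport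
      (by have := hφ1.continuous_fderiv one_ne_zero; fun_prop) (hφc.fderiv_apply ℝ _).mul_left
  rw [← setIntegral_eq_integral_of_forall_compl_eq_zero (mul_fderiv_eq_zero_of_notMem hφU _ _)]
  calc ∫ z in U, U.indicator (fun z => u z - ℓ (z - x)) z *
        fderiv ℝ φ z (EuclideanSpace.single i 1)
      = ∫ z in U, (u z * fderiv ℝ φ z (EuclideanSpace.single i 1) -
          ℓ (z - x) * fderiv ℝ φ z (EuclideanSpace.single i 1)) :=
        setIntegral_congr_fun hU fun z hz => by simp only [Set.indicator_of_mem hz, sub_mul]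
    _ = -signedIntegral ν φ + ℓ (EuclideanSpace.single i 1) * ∫ z, φ z := by
        rw [integral_sub (integrable_mul_fderiv hu hφ1 hφc _) hℓ.integrableOn, hν φ hφ hφc hφU,
          setIntegral_eq_integral_of_forall_compl_eq_zero (mul_fderiv_eq_zero_of_notMem hφU _ _),
          integral_clm_sub_mul_fderiv ℓ x _ hφ1 hφc, sub_neg_eq_add]

end DistribDeriv

section Dilation

/-- The dilation `z ↦ s ^ n * η (s • (x - z))` concentrating `η` around `x` as `s → ∞`. The factor
`s ^ n` preserves the integral, and the argument is reflected so that integrals against `dilate`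
are convolutions. -/
noncomputable def dilate {n : ℕ} (η : EuclideanSpace ℝ (Fin n) → ℝ) (x : EuclideanSpace ℝ (Fin n))
    (s : ℝ) (z : EuclideanSpace ℝ (Fin n)) : ℝ :=
  s ^ n * η (s • (x - z))

variable {n : ℕ} {v η ψ : EuclideanSpace ℝ (Fin n) → ℝ} {x : EuclideanSpace ℝ (Fin n)} {s R : ℝ}

theorem sum_fderiv_coord_sub_mul {z : EuclideanSpace ℝ (Fin n)} (hψ : DifferentiableAt ℝ ψ z)
    (x : EuclideanSpace ℝ (Fin n)) :
    ∑ i, fderiv ℝ (fun z => (z i - x i) * ψ z) z (EuclideanSpace.single i 1) =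
      n * ψ z + fderiv ℝ ψ z (z - x) := by
  have hterm (i : Fin n) : fderiv ℝ (fun z => (z i - x i) * ψ z) z (EuclideanSpace.single i 1) =
      ψ z + fderiv ℝ ψ z ((z i - x i) • EuclideanSpace.single i 1) := by
    have hcoord : HasFDerivAt (fun z : EuclideanSpace ℝ (Fin n) => z i - x i)
        (EuclideanSpace.proj (𝕜 := ℝ) i) z :=
      (EuclideanSpace.proj (𝕜 := ℝ) i).hasFDerivAt.sub_const (x i)
    rw [(hcoord.fun_mul hψ.hasFDerivAt).fderiv]
    simp [add_comm]
  have hbasis : ∑ i, (z i - x i) • EuclideanSpace.single i (1 : ℝ) = z - x := by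
    simpa using (EuclideanSpace.basisFun (Fin n) ℝ).sum_repr (z - x)
  rw [Finset.sum_congr rfl fun i _ => hterm i, Finset.sum_add_distrib, ← map_sum, hbasis]
  simp

theorem contDiff_dilate (hη : ContDiff ℝ ∞ η) (x : EuclideanSpace ℝ (Fin n)) (s : ℝ) :
    ContDiff ℝ ∞ (dilate η x s) :=
  contDiff_const.mul (hη.comp ((contDiff_const.sub contDiff_id).const_smul s))

theorem contDiff_coord_sub_mul (hψ : ContDiff ℝ ∞ ψ) (x : EuclideanSpace ℝ (Fin n)) (i : Fin n) :
    ContDiff ℝ ∞ fun z => (z i - x i) * ψ z :=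
  ((EuclideanSpace.proj (𝕜 := ℝ) i).contDiff.sub contDiff_const).mul hψ

theorem hasDerivAt_dilate (hη : Differentiable ℝ η) (s : ℝ) (x z : EuclideanSpace ℝ (Fin n)) :
    HasDerivAt (fun s => dilate η x s z)
      (n * s ^ (n - 1) * η (s • (x - z)) + s ^ n * fderiv ℝ η (s • (x - z)) (x - z)) s := by
  have hsmul : HasDerivAt (fun s : ℝ => s • (x - z)) (x - z) s := by
    simpa using (hasDerivAt_id s).smul_const (x - z)
  exact (hasDerivAt_pow n s).mul ((hη _).hasFDerivAt.comp_hasDerivAt s hsmul)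

theorem fderiv_dilate (hη : Differentiable ℝ η) (s : ℝ) (x z w : EuclideanSpace ℝ (Fin n)) :
    fderiv ℝ (dilate η x s) z w = -(s ^ n * (s * fderiv ℝ η (s • (x - z)) w)) := by
  have hsmul : HasFDerivAt (fun z => s • (x - z)) (s • -ContinuousLinearMap.id ℝ _) z :=
    ((hasFDerivAt_id z).const_sub x).const_smul s
  rw [HasFDerivAt.fderiv (f := dilate η x s) (((hη _).hasFDerivAt.comp z hsmul).const_mul _)]
  simp

theorem deriv_dilate_eq_sum_fderiv (hη : Differentiable ℝ η) (hs : 0 < s)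
    (x z : EuclideanSpace ℝ (Fin n)) :
    deriv (fun s => dilate η x s z) s =
      s⁻¹ * ∑ i, fderiv ℝ (fun z => (z i - x i) * dilate η x s z) z
        (EuclideanSpace.single i 1) := by
  have hdiff : Differentiable ℝ (dilate η x s) :=
    (hη.comp ((differentiable_const x).sub differentiable_id |>.const_smul s)).const_mul _
  have hpow : (n : ℝ) * s ^ (n - 1) = s⁻¹ * (n * s ^ n) := by
    rcases n with _ | k
    · simp
    · simp only [Nat.add_sub_cancel, pow_succ]
      field_simp
  rw [(hasDerivAt_dilate hη s x z).deriv, sum_fderiv_coord_sub_mul (hdiff z), fderiv_dilate hη,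
    ← neg_sub x z, map_neg, hpow, dilate]
  field_simp

theorem mem_ball_of_smul_sub_mem_ball {z : EuclideanSpace ℝ (Fin n)} (hs : 0 < s)
    (hz : s • (x - z) ∈ Metric.ball 0 R) : z ∈ Metric.ball x (R / s) := by
  rw [mem_ball_zero_iff, norm_smul, Real.norm_of_nonneg hs.le] at hz
  rwa [mem_ball_iff_norm', lt_div_iff₀' hs]

theorem tsupport_dilate_subset (hs : 0 < s) (hηR : tsupport η ⊆ Metric.ball 0 R) :
    tsupport (dilate η x s) ⊆ Metric.ball x (R / s) := by
  have hpre : tsupport (dilate η x s) ⊆ (fun z => s • (x - z)) ⁻¹' tsupport η :=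
    (tsupport_mul_subset_right (f := fun _ => s ^ n)).trans
      (tsupport_comp_subset_preimage η (by fun_prop))
  exact fun z hz => mem_ball_of_smul_sub_mem_ball hs (hηR (hpre hz))

theorem hasCompactSupport_of_tsupport_subset_ball {X M : Type*} [PseudoMetricSpace X]
    [ProperSpace X] [Zero M] {φ : X → M} {x : X} {ρ : ℝ} (h : tsupport φ ⊆ Metric.ball x ρ) :
    HasCompactSupport φ :=
  Metric.isCompact_of_isClosed_isBounded (isClosed_tsupport φ) (Metric.isBounded_ball.subset h)

theorem hasDerivAt_integral_mul_of_hasCompactSupport {X : Type*} [TopologicalSpace X]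
    [MeasurableSpace X] [OpensMeasurableSpace X] {μ : Measure X} {v : X → ℝ} (hv : Integrable v μ)
    {Φ Φ' : ℝ → X → ℝ} (hΦ : ∀ s z, HasDerivAt (fun s => Φ s z) (Φ' s z) s)
    (hcont : ∀ s, Continuous (Φ s)) (hcont' : Continuous (Function.uncurry Φ')) {s₀ : ℝ}
    (hΦs₀ : HasCompactSupport (Φ s₀)) {K : Set X} (hK : IsCompact K)
    (hΦK : ∀ᶠ s in 𝓝 s₀, ∀ z ∉ K, Φ' s z = 0) :
    HasDerivAt (fun s => ∫ z, v z * Φ s z ∂μ) (∫ z, v z * Φ' s₀ z ∂μ) s₀ := by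
  obtain ⟨r, hr, hrK⟩ := Metric.nhds_basis_closedBall.eventually_iff.1 hΦK
  obtain ⟨C, hC⟩ := ((isCompact_closedBall s₀ r).prod hK).exists_bound_of_continuousOn
    hcont'.continuousOn
  have hbound : ∀ s ∈ Metric.closedBall s₀ r, ∀ z, ‖Φ' s z‖ ≤ max C 0 := fun s hs z => by
    by_cases hz : z ∈ K
    · exact (hC (s, z) ⟨hs, hz⟩).trans (le_max_left _ _)
    · simp [hrK hs z hz]
  obtain ⟨C₀, hC₀⟩ := (hcont s₀).bounded_above_of_compact_support hΦs₀
  refine (hasDerivAt_integral_of_dominated_loc_of_deriv_le (Metric.closedBall_mem_nhds s₀ hr)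
    (.of_forall fun s => hv.aestronglyMeasurable.mul (hcont s).aestronglyMeasurable)
    (hv.mul_bdd (hcont s₀).aestronglyMeasurable (.of_forall hC₀))
    (hv.aestronglyMeasurable.mul (hcont'.uncurry_left s₀).aestronglyMeasurable)
    (.of_forall fun z s hs => ?_) (hv.norm.mul_const (max C 0))
    (.of_forall fun z s _ => (hΦ s z).const_mul (v z))).2
  rw [norm_mul]
  exact mul_le_mul_of_nonneg_left (hbound s hs z) (norm_nonneg _)

theorem hasDerivAt_integral_mul_dilate (hv : Integrable v) (hη : ContDiff ℝ ∞ η)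
    (hηR : tsupport η ⊆ Metric.ball 0 R) (x : EuclideanSpace ℝ (Fin n)) (hs : 0 < s) :
    HasDerivAt (fun s => ∫ z, v z * dilate η x s z)
      (s⁻¹ * ∑ i, ∫ z, v z * fderiv ℝ (fun z => (z i - x i) * dilate η x s z) z
        (EuclideanSpace.single i 1)) s := by
  have hηd : Differentiable ℝ η := hη.differentiable (by simp)
  have hηc : Continuous (fderiv ℝ η) := hη.continuous_fderiv (by simp)
  have hcompact :=
    hasCompactSupport_of_tsupport_subset_ball (tsupport_dilate_subset (x := x) hs hηR)
  have hderiv := hasDerivAt_integral_mul_of_hasCompactSupport hv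
    (fun s z => hasDerivAt_dilate hηd s x z) (fun s => (contDiff_dilate hη x s).continuous)
    (by have := hη.continuous; fun_prop) hcompact
    (isCompact_closedBall x (R / (s / 2))) ?_
  · convert hderiv using 1
    have hψ (i : Fin n) : ContDiff ℝ 1 fun z => (z i - x i) * dilate η x s z :=
      (contDiff_coord_sub_mul (contDiff_dilate hη x s) x i).of_le (by exact_mod_cast le_top)
    rw [← integral_finsetSum _ fun i _ =>
      integrable_mul_fderiv hv (hψ i) hcompact.mul_left _, ← integral_const_mul]
    refine integral_congr_ae (.of_forall fun z => ?_)
    simp only [← (hasDerivAt_dilate hηd s x z).deriv, deriv_dilate_eq_sum_fderiv hηd hs,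
      Finset.mul_sum, mul_left_comm]
  · filter_upwards [lt_mem_nhds (half_lt_self hs)] with s' hs' z hz
    have hnot : s' • (x - z) ∉ tsupport η := fun h => by
      refine hz (Metric.ball_subset_closedBall (mem_ball_of_smul_sub_mem_ball (half_pos hs) ?_))
      have hlt := mem_ball_zero_iff.1 (hηR h)
      rw [norm_smul, Real.norm_of_nonneg (half_pos hs |>.trans hs').le] at hlt
      rw [mem_ball_zero_iff, norm_smul, Real.norm_of_nonneg (half_pos hs).le]
      exact (mul_le_mul_of_nonneg_right hs'.le (norm_nonneg _)).trans_lt hlt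
    rw [image_eq_zero_of_notMem_tsupport hnot, fderiv_of_notMem_tsupport ℝ hnot]
    simp

end Dilation

section GradientMass

theorem abs_sub_le_of_abs_deriv_le_div_sq {M M' : ℝ → ℝ} {C L : ℝ}
    (hM : ∀ s ≥ 1, HasDerivAt M (M' s) s) (hM' : ∀ s ≥ 1, |M' s| ≤ C / s ^ 2)
    (hL : Tendsto M atTop (𝓝 L)) : |L - M 1| ≤ C := by
  have hC : 0 ≤ C := by simpa using (abs_nonneg _).trans (hM' 1 le_rfl)
  have hbarrier (s : ℝ) (hs : 1 ≤ s) : HasDerivAt (fun s => C * (1 - s⁻¹)) (C / s ^ 2) s := by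
    have hinv := ((hasDerivAt_inv (by positivity : s ≠ 0)).const_sub 1).const_mul C
    rwa [neg_neg, ← div_eq_mul_inv] at hinv
  refine le_of_tendsto (hL.sub_const (M 1)).abs ?_
  filter_upwards [eventually_ge_atTop 1] with t ht
  have hle := image_norm_le_of_norm_deriv_right_le_deriv_boundary' (a := 1) (b := t)
    (f := fun s => M s - M 1) (B := fun s => C * (1 - s⁻¹))
    (fun s hs => ((hM s hs.1).sub_const _).continuousAt.continuousWithinAt)
    (fun s hs => ((hM s hs.1).sub_const _).hasDerivWithinAt) (by simp)
    (fun s hs => (hbarrier s hs.1).continuousAt.continuousWithinAt)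
    (fun s hs => (hbarrier s hs.1).hasDerivWithinAt) (fun s hs => hM' s hs.1)
    (Set.right_mem_Icc.2 ht)
  refine hle.trans (mul_le_of_le_one_right hC ?_)
  linarith [inv_nonneg.2 (zero_le_one.trans ht)]

theorem measureReal_closedBall_mul {E : Type*} [NormedAddCommGroup E] [NormedSpace ℝ E]
    [MeasurableSpace E] [BorelSpace E] [FiniteDimensional ℝ E] (μ : Measure E)
    [μ.IsAddHaarMeasure] (x y : E) {a r : ℝ} (ha : 0 ≤ a) (hr : 0 ≤ r) :
    μ.real (Metric.closedBall x (a * r)) =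
      a ^ Module.finrank ℝ E * μ.real (Metric.closedBall y r) := by
  rw [Measure.addHaar_real_closedBall μ x (mul_nonneg ha hr),
    Measure.addHaar_real_closedBall μ y hr, mul_pow, mul_assoc]

variable {n : ℕ} {v η : EuclideanSpace ℝ (Fin n) → ℝ} {x : EuclideanSpace ℝ (Fin n)}
  {R S ε : ℝ}

/-- The distributional gradient of `v` has mass at most `ε * |B(x, ρ)|`, per coordinate, in each
ball `B(x, ρ)` with `ρ ≤ R`. This is expressed by duality, so that `v` need not be of bounded
variation globally. -/
def HasGradientMassLE (v : EuclideanSpace ℝ (Fin n) → ℝ) (x : EuclideanSpace ℝ (Fin n))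
    (R ε : ℝ) : Prop :=
  ∀ ρ ∈ Set.Ioc 0 R, ∀ (i : Fin n) (φ : EuclideanSpace ℝ (Fin n) → ℝ) (c : ℝ), ContDiff ℝ ∞ φ →
    (∀ z, |φ z| ≤ c) → tsupport φ ⊆ Metric.ball x ρ →
      |∫ z, v z * fderiv ℝ φ z (EuclideanSpace.single i 1)| ≤
        c * ε * volume.real (Metric.closedBall x ρ)

theorem HasGradientMassLE.mono {R' : ℝ} (h : HasGradientMassLE v x R ε) (hR : R' ≤ R) :
    HasGradientMassLE v x R' ε :=
  fun ρ hρ => h ρ ⟨hρ.1, hρ.2.trans hR⟩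

theorem abs_coord_sub_mul_dilate_le (hR : 0 ≤ R) (hηS : ∀ z, |η z| ≤ S)
    (hηR : tsupport η ⊆ Metric.ball 0 R) {s : ℝ} (hs : 0 < s) (x z : EuclideanSpace ℝ (Fin n))
    (i : Fin n) : |(z i - x i) * dilate η x s z| ≤ R / s * (s ^ n * S) := by
  have hS : 0 ≤ S := (abs_nonneg _).trans (hηS 0)
  by_cases hz : dilate η x s z = 0
  · rw [hz, mul_zero, abs_zero]
    positivity
  · have hzx : ‖z - x‖ < R / s :=
      mem_ball_iff_norm.1 (tsupport_dilate_subset hs hηR (subset_tsupport _ hz))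
    rw [abs_mul, dilate, abs_mul, abs_of_pos (pow_pos hs n)]
    gcongr
    · exact (PiLp.norm_apply_le (z - x) i).trans hzx.le
    · exact hηS _

theorem HasGradientMassLE.abs_deriv_integral_mul_dilate_le (h : HasGradientMassLE v x R ε)
    (hR : 0 < R) (hη : ContDiff ℝ ∞ η) (hηS : ∀ z, |η z| ≤ S)
    (hηR : tsupport η ⊆ Metric.ball 0 R) {s : ℝ} (hs : 1 ≤ s) :
    |s⁻¹ * ∑ i, ∫ z, v z * fderiv ℝ (fun z => (z i - x i) * dilate η x s z) z
        (EuclideanSpace.single i 1)| ≤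
      n * (R * S * ε * volume.real (Metric.closedBall x R)) / s ^ 2 := by
  have hs0 : 0 < s := zero_lt_one.trans_le hs
  have hterm (i : Fin n) : |∫ z, v z * fderiv ℝ (fun z => (z i - x i) * dilate η x s z) z
      (EuclideanSpace.single i 1)| ≤ R * S * ε * volume.real (Metric.closedBall x R) / s := by
    have hsupp : tsupport (fun z => (z i - x i) * dilate η x s z) ⊆ Metric.ball x (R / s) :=
      (tsupport_mul_subset_right (f := fun z : EuclideanSpace ℝ (Fin n) => z i - x i)).trans
        (tsupport_dilate_subset hs0 hηR)
    refine (h (R / s) ⟨div_pos hR hs0, div_le_self hR.le hs⟩ i _ _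
      (contDiff_coord_sub_mul (contDiff_dilate hη x s) x i)
      (fun z => abs_coord_sub_mul_dilate_le hR.le hηS hηR hs0 x z i) hsupp).trans_eq ?_
    rw [div_eq_inv_mul R s, measureReal_closedBall_mul volume x x (inv_nonneg.2 hs0.le) hR.le,
      finrank_euclideanSpace_fin, inv_pow]
    field_simp
  rw [abs_mul, abs_of_pos (inv_pos.2 hs0)]
  calc s⁻¹ * |∑ i, ∫ z, v z * fderiv ℝ (fun z => (z i - x i) * dilate η x s z) z
          (EuclideanSpace.single i 1)|
      ≤ s⁻¹ * ∑ _i : Fin n, R * S * ε * volume.real (Metric.closedBall x R) / s := by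
        gcongr
        exact (Finset.abs_sum_le_sum_abs _ _).trans (Finset.sum_le_sum fun i _ => hterm i)
    _ = n * (R * S * ε * volume.real (Metric.closedBall x R)) / s ^ 2 := by
        rw [Finset.sum_const, Finset.card_univ, Fintype.card_fin, nsmul_eq_mul]
        field_simp

theorem tendsto_integral_mul_dilate (hv : Integrable v) (hvx : ContinuousAt v x)
    (hη0 : ∀ z, 0 ≤ η z) (hη1 : ∫ z, η z = 1) (hηc : HasCompactSupport η) :
    Tendsto (fun s => ∫ z, v z * dilate η x s z) atTop (𝓝 (v x)) := by
  have hzero : (fun z => ‖z‖ ^ Module.finrank ℝ (EuclideanSpace ℝ (Fin n)) * η z) =ᶠ[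
      Bornology.cobounded _] 0 := by
    filter_upwards [Bornology.isBounded_def.1 (hηc.isCompact.isBounded)] with z hz
    simp [image_eq_zero_of_notMem_tsupport hz]
  have hlim := tendsto_integral_comp_smul_smul_of_integrable' hη0 hη1
    (tendsto_const_nhds.congr' hzero.symm) hv hvx
  simpa only [dilate, finrank_euclideanSpace_fin, smul_eq_mul, mul_comm] using hlim

theorem HasGradientMassLE.abs_sub_integral_mul_le (h : HasGradientMassLE v x R ε) (hR : 0 < R)
    (hv : Integrable v) (hvx : ContinuousAt v x) (hη : ContDiff ℝ ∞ η) (hη0 : ∀ z, 0 ≤ η z)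
    (hη1 : ∫ z, η z = 1) (hηS : ∀ z, η z ≤ S) (hηR : tsupport η ⊆ Metric.ball 0 R) :
    |v x - ∫ z, v z * η (x - z)| ≤
      n * (R * S * ε * volume.real (Metric.closedBall x R)) := by
  have hηS' : ∀ z, |η z| ≤ S := fun z => (abs_of_nonneg (hη0 z)).trans_le (hηS z)
  have hle := abs_sub_le_of_abs_deriv_le_div_sq
    (fun s hs => hasDerivAt_integral_mul_dilate hv hη hηR x (zero_lt_one.trans_le hs))
    (fun s hs => h.abs_deriv_integral_mul_dilate_le hR hη hηS' hηR hs)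
    (tendsto_integral_mul_dilate hv hvx hη0 hη1 (hasCompactSupport_of_tsupport_subset_ball hηR))
  simpa only [dilate, one_pow, one_mul, one_smul] using hle

theorem exists_contDiff_nonneg_integral_eq_one {E : Type*} [NormedAddCommGroup E]
    [NormedSpace ℝ E] [FiniteDimensional ℝ E] [MeasurableSpace E] [BorelSpace E] (μ : Measure E)
    [μ.IsAddHaarMeasure] {r : ℝ} (hr : 0 < r) :
    ∃ η : E → ℝ, ContDiff ℝ ∞ η ∧ (∀ z, 0 ≤ η z) ∧ ∫ z, η z ∂μ = 1 ∧
      tsupport η ⊆ Metric.ball 0 r ∧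
      ∀ z, η z ≤ 4 ^ Module.finrank ℝ E / μ.real (Metric.closedBall 0 r) := by
  let b : ContDiffBump (0 : E) := ⟨r / 4, r / 2, by positivity, by linarith⟩
  have hvol : μ.real (Metric.closedBall (0 : E) r) =
      4 ^ Module.finrank ℝ E * μ.real (Metric.closedBall (0 : E) b.rIn) := by
    rw [← measureReal_closedBall_mul μ 0 0 zero_le_four b.rIn_pos.le]
    exact congrArg (fun a => μ.real (Metric.closedBall 0 a)) (by simp only [b]; ring)
  refine ⟨b.normed μ, b.contDiff_normed, b.nonneg_normed, b.integral_normed, ?_, fun z => ?_⟩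
  · rw [b.tsupport_normed_eq]
    exact Metric.closedBall_subset_ball (half_lt_self hr)
  · rw [hvol, div_mul_cancel_left₀ (by positivity), ← one_div]
    exact b.normed_le_div_measure_closedBall_rIn μ z

theorem tsupport_comp_add_right_subset_ball {E : Type*} [NormedAddCommGroup E] {η : E → ℝ}
    {r : ℝ} (hη : tsupport η ⊆ Metric.ball 0 r) (a : E) :
    tsupport (fun z => η (z + a)) ⊆ Metric.ball 0 (r + ‖a‖) := by
  intro z hz
  have hza : z + a ∈ Metric.ball 0 r :=
    hη (tsupport_comp_subset_preimage η (continuous_add_const a) hz)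
  rw [mem_ball_zero_iff] at hza ⊢
  calc ‖z‖ = ‖z + a - a‖ := by rw [add_sub_cancel_right]
    _ ≤ ‖z + a‖ + ‖a‖ := norm_sub_le _ _
    _ < r + ‖a‖ := by gcongr

theorem abs_sub_le_of_hasGradientMassLE {y : EuclideanSpace ℝ (Fin n)} {δ M : ℝ}
    (hδ : δ ∈ Set.Ioc 0 1) (hv : Integrable v) (hvx : ContinuousAt v x) (hvy : ContinuousAt v y)
    (hx : HasGradientMassLE v x (2 * ‖y - x‖) ε) (hy : HasGradientMassLE v y (δ * ‖y - x‖) M) :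
    |v y - v x| ≤ (n * 4 ^ n * M * δ + 2 * n * (8 / δ) ^ n * ε) * ‖y - x‖ := by
  rcases eq_or_ne y x with rfl | hyx
  · simp
  set r := ‖y - x‖
  have hr : 0 < r := norm_pos_iff.2 (sub_ne_zero.2 hyx)
  have hδr : 0 < δ * r := mul_pos hδ.1 hr
  obtain ⟨η, hη, hη0, hη1, hηr, hηS⟩ :=
    exists_contDiff_nonneg_integral_eq_one (E := EuclideanSpace ℝ (Fin n)) volume hδr
  rw [finrank_euclideanSpace_fin] at hηS
  set V := volume.real (Metric.closedBall (0 : EuclideanSpace ℝ (Fin n)) (δ * r))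
  have hV : 0 < V := ENNReal.toReal_pos (Metric.measure_closedBall_pos _ _ hδr).ne'
    measure_closedBall_lt_top.ne
  have hVy : volume.real (Metric.closedBall y (δ * r)) = V := by
    simpa using measureReal_closedBall_mul volume y 0 zero_le_one hδr.le
  have hVx : volume.real (Metric.closedBall x (2 * r)) = (2 / δ) ^ n * V := by
    have hscale := measureReal_closedBall_mul volume x 0 (div_pos two_pos hδ.1).le hδr.le
    rwa [← mul_assoc, div_mul_cancel₀ _ hδ.1.ne', finrank_euclideanSpace_fin] at hscale
  -- Both estimates refer to the same average `∫ v(z) η(y - z) dz`: seen from `x`, its kernel is `η`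
  -- translated by `y - x`.
  have hyη := hy.abs_sub_integral_mul_le hδr hv hvy hη hη0 hη1 hηS hηr
  have hxη := hx.abs_sub_integral_mul_le (η := fun z => η (z + (y - x))) (by positivity) hv hvx
    (hη.comp (contDiff_id.add contDiff_const)) (fun z => hη0 _)
    (by rwa [integral_add_right_eq_self]) (fun z => hηS _) ?_
  · simp only [sub_add_sub_cancel', hVx] at hxη
    rw [hVy] at hyη
    calc |v y - v x|
        ≤ |v y - ∫ z, v z * η (y - z)| + |v x - ∫ z, v z * η (y - z)| := by
          rw [abs_sub_comm (v x)]
          exact abs_sub_le _ _ _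
      _ ≤ n * (δ * r * (4 ^ n / V) * M * V) +
          n * (2 * r * (4 ^ n / V) * ε * ((2 / δ) ^ n * V)) :=
          add_le_add hyη hxη
      _ = (n * 4 ^ n * M * δ + 2 * n * (8 / δ) ^ n * ε) * r := by
          rw [show (8 : ℝ) / δ = 4 * (2 / δ) by ring, mul_pow]
          field_simp
  · refine (tsupport_comp_add_right_subset_ball hηr (y - x)).trans (Metric.ball_subset_ball ?_)
    linarith [mul_le_of_le_one_left hr.le hδ.2]

theorem hasFDerivWithinAt_zero_of_hasGradientMassLE {T : Set (EuclideanSpace ℝ (Fin n))}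
    (hv : Integrable v) (hcont : ∀ᶠ y in 𝓝 x, ContinuousAt v y)
    (hx : ∀ ε > 0, ∃ R > 0, HasGradientMassLE v x R ε)
    (hT : ∃ M, ∃ R > 0, ∀ᶠ y in 𝓝[T] x, HasGradientMassLE v y R M) :
    HasFDerivWithinAt v (0 : EuclideanSpace ℝ (Fin n) →L[ℝ] ℝ) T x := by
  obtain ⟨M, R, hR, hMR⟩ := hT
  refine .of_isLittleO (Asymptotics.isLittleO_iff.2 fun c hc => ?_)
  have hlim : Tendsto (fun δ : ℝ => n * 4 ^ n * M * δ) (𝓝[>] 0) (𝓝 0) :=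
    ((continuous_const_mul (n * 4 ^ n * M)).tendsto' 0 0 (mul_zero _)).mono_left
      nhdsWithin_le_nhds
  obtain ⟨δ, hδM, hδ⟩ := ((hlim.eventually_lt_const (half_pos hc)).and
    (Ioc_mem_nhdsGT (one_pos (α := ℝ)))).exists
  obtain ⟨ε, hε, hεδ⟩ := exists_pos_mul_lt (half_pos hc) (2 * n * (8 / δ) ^ n)
  obtain ⟨R', hR', hεR'⟩ := hx ε hε
  filter_upwards [hMR, mem_nhdsWithin_of_mem_nhds (Metric.ball_mem_nhds x
    (lt_min hR (half_pos hR'))), hcont.filter_mono nhdsWithin_le_nhds] with y hyM hyx hvy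
  obtain ⟨hyR, hyR'⟩ := lt_min_iff.1 (mem_ball_iff_norm.1 hyx)
  have hδy : δ * ‖y - x‖ ≤ R := (mul_le_of_le_one_left (norm_nonneg _) hδ.2).trans hyR.le
  have hle := abs_sub_le_of_hasGradientMassLE hδ hv hcont.self_of_nhds hvy
    (hεR'.mono (by linarith)) (hyM.mono hδy)
  rw [zero_apply, sub_zero, Real.norm_eq_abs]
  exact hle.trans (by gcongr; linarith)

end GradientMass

section BVDifferentiability

variable {n : ℕ} {U : Set (EuclideanSpace ℝ (Fin n))} {u : EuclideanSpace ℝ (Fin n) → ℝ}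
  {ν : Fin n → SignedMeasure (EuclideanSpace ℝ (Fin n))} {x : EuclideanSpace ℝ (Fin n)}
  {ℓ : EuclideanSpace ℝ (Fin n) →L[ℝ] ℝ}

theorem hasGradientMassLE_of_hasDensityAt (hU : IsOpen U) (hu : IntegrableOn u U)
    (hν : ∀ i, HasDistribPartialDeriv U u i (ν i)) (hx : x ∈ U)
    (hℓ : ∀ i, HasDensityAt (signedIntegral (ν i)) volume x (ℓ (EuclideanSpace.single i 1)))
    {ε : ℝ} (hε : 0 < ε) :
    ∃ R > 0, HasGradientMassLE (U.indicator fun z => u z - ℓ (z - x)) x R ε := by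
  obtain ⟨r, hr, hrU⟩ := Metric.isOpen_iff.1 hU x hx
  obtain ⟨R, hR, hRsub⟩ := mem_nhdsGT_iff_exists_Ioc_subset.1
    ((eventually_all.2 fun i => hℓ i ε hε).and (Ioc_mem_nhdsGT hr))
  refine ⟨R, hR, fun ρ hρ i φ c hφ hc hφρ => ?_⟩
  obtain ⟨hdensity, -, hρr⟩ := hRsub hρ
  rw [(hν i).integral_indicator_sub_clm_mul_fderiv hU.measurableSet hu ℓ x hφ
    (hasCompactSupport_of_tsupport_subset_ball hφρ)
    (hφρ.trans ((Metric.ball_subset_ball hρr).trans hrU)), neg_add_eq_sub, abs_sub_comm]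
  exact hdensity i φ c hφ.continuous.measurable hc
    ((subset_tsupport φ).trans (hφρ.trans Metric.ball_subset_closedBall))

theorem hasGradientMassLE_of_mem_densityBoundedSet (hU : MeasurableSet U)
    (hu : IntegrableOn u U) (hν : ∀ i, HasDistribPartialDeriv U u i (ν i))
    {σ : Measure (EuclideanSpace ℝ (Fin n))} (hσ : ∀ i, (ν i).totalVariation ≤ σ) {m : ℕ}
    {y : EuclideanSpace ℝ (Fin n)} (hy : y ∈ densityBoundedSet σ volume m) {R : ℝ}
    (hRm : R ≤ 1 / (m + 1)) (hRU : Metric.ball y R ⊆ U) :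
    HasGradientMassLE (U.indicator fun z => u z - ℓ (z - x)) y R (m + ‖ℓ‖) := by
  intro ρ hρ i φ c hφ hc hφρ
  have hc0 : 0 ≤ c := (abs_nonneg _).trans (hc y)
  have hsupp : Function.support φ ⊆ Metric.ball y ρ := (subset_tsupport φ).trans hφρ
  have hTV : (ν i).totalVariation.real (Metric.ball y ρ) ≤
      m * volume.real (Metric.closedBall y ρ) := by
    rw [← ENNReal.toReal_natCast, measureReal_def, measureReal_def, ← ENNReal.toReal_mul]
    exact ENNReal.toReal_mono
      (ENNReal.mul_ne_top (ENNReal.natCast_ne_top m) measure_closedBall_lt_top.ne)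
      ((hσ i _).trans (hy ρ ⟨hρ.1, hρ.2.trans hRm⟩))
  have hsing : |signedIntegral (ν i) φ| ≤ c * (m * volume.real (Metric.closedBall y ρ)) :=
    (abs_signedIntegral_le_of_support_subset (ν i) hc hsupp).trans (by gcongr)
  have hℓi : |ℓ (EuclideanSpace.single i 1)| ≤ ‖ℓ‖ := by
    simpa using ℓ.le_opNorm (EuclideanSpace.single i 1)
  have hint : |∫ z, φ z| ≤ c * volume.real (Metric.closedBall y ρ) :=
    abs_integral_le_of_support_subset measure_closedBall_lt_top hc
      (hsupp.trans Metric.ball_subset_closedBall)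
  rw [(hν i).integral_indicator_sub_clm_mul_fderiv hU hu ℓ x hφ
    (hasCompactSupport_of_tsupport_subset_ball hφρ)
    (hφρ.trans ((Metric.ball_subset_ball hρ.2).trans hRU))]
  calc |-signedIntegral (ν i) φ + ℓ (EuclideanSpace.single i 1) * ∫ z, φ z|
      ≤ |signedIntegral (ν i) φ| + |ℓ (EuclideanSpace.single i 1)| * |∫ z, φ z| := by
        rw [← abs_mul, ← abs_neg (signedIntegral (ν i) φ)]
        exact abs_add_le _ _
    _ ≤ c * (m * volume.real (Metric.closedBall y ρ)) +
        ‖ℓ‖ * (c * volume.real (Metric.closedBall y ρ)) := by gcongr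
    _ = c * (m + ‖ℓ‖) * volume.real (Metric.closedBall y ρ) := by ring

theorem hasFDerivWithinAt_densityBoundedSet (hU : IsOpen U) (hUb : Bornology.IsBounded U)
    (huc : ContinuousOn u U) (hu : IntegrableOn u U)
    (hν : ∀ i, HasDistribPartialDeriv U u i (ν i)) {σ : Measure (EuclideanSpace ℝ (Fin n))}
    (hσ : ∀ i, (ν i).totalVariation ≤ σ) (m : ℕ) (hx : x ∈ U)
    (hℓ : ∀ i, HasDensityAt (signedIntegral (ν i)) volume x (ℓ (EuclideanSpace.single i 1))) :
    HasFDerivWithinAt u ℓ (densityBoundedSet σ volume m) x := by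
  set v := U.indicator fun z => u z - ℓ (z - x)
  have hv : Integrable v := by
    have hℓi : IntegrableOn (fun z => ℓ (z - x)) U :=
      (Continuous.continuousOn (by fun_prop) |>.integrableOn_compact
        hUb.isCompact_closure).mono_set subset_closure
    exact (hu.sub hℓi).integrable_indicator hU.measurableSet
  have hvU : Set.EqOn v (fun z => u z - ℓ (z - x)) U := fun z hz => Set.indicator_of_mem hz _
  have hvc : ∀ᶠ y in 𝓝 x, ContinuousAt v y := by
    filter_upwards [hU.mem_nhds hx] with y hy
    have hcont : ContinuousAt (fun z => u z - ℓ (z - x)) y :=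
      (huc.continuousAt (hU.mem_nhds hy)).sub (by fun_prop)
    exact hcont.congr (hvU.eventuallyEq_of_mem (hU.mem_nhds hy)).symm
  obtain ⟨r, hr, hrU⟩ := Metric.isOpen_iff.1 hU x hx
  have hmass : ∃ M, ∃ R > 0, ∀ᶠ y in 𝓝[densityBoundedSet σ volume m] x,
      HasGradientMassLE v y R M := by
    refine ⟨m + ‖ℓ‖, min (r / 2) (1 / (m + 1)), by positivity, ?_⟩
    filter_upwards [self_mem_nhdsWithin,
      mem_nhdsWithin_of_mem_nhds (Metric.ball_mem_nhds x (half_pos hr))] with y hy hyx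
    refine hasGradientMassLE_of_mem_densityBoundedSet hU.measurableSet hu hν hσ hy
      (min_le_right _ _) ((Metric.ball_subset_ball' ?_).trans hrU)
    linarith [min_le_left (r / 2) (1 / (m + 1) : ℝ), Metric.mem_ball.1 hyx]
  have hv' := hasFDerivWithinAt_zero_of_hasGradientMassLE hv hvc
    (fun ε hε => hasGradientMassLE_of_hasDensityAt hU hu hν hx hℓ hε) hmass
  have hsum := hv'.add (ℓ.hasFDerivAt.comp x ((hasFDerivAt_id x).sub_const x)).hasFDerivWithinAt
  rw [zero_add, ContinuousLinearMap.comp_id] at hsum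
  refine hsum.congr_of_eventuallyEq ?_ ?_
  · filter_upwards [mem_nhdsWithin_of_mem_nhds (hU.mem_nhds hx)] with z hz
    simp [hvU hz]
  · simp [hvU hx]

theorem toEuclideanCLM_single_apply (M : Matrix (Fin n) (Fin n) ℝ) (i j : Fin n) :
    Matrix.toEuclideanCLM (𝕜 := ℝ) M (EuclideanSpace.single i 1) j = M j i := by
  simp [Matrix.ofLp_toEuclideanCLM]

theorem det_toEuclideanCLM (M : Matrix (Fin n) (Fin n) ℝ) :
    (Matrix.toEuclideanCLM (𝕜 := ℝ) M).det = M.det := by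
  rw [ContinuousLinearMap.det, Matrix.coe_toEuclideanCLM_eq_toEuclideanLin]
  exact LinearMap.det_toLpLin 2 M

variable {f : EuclideanSpace ℝ (Fin n) → EuclideanSpace ℝ (Fin n)}

theorem hasPiecewiseFDerivOn_of_forall_isBV (hU : IsOpen U) (hUb : Bornology.IsBounded U)
    (hf : ContinuousOn f U) (hBV : ∀ j, IsBV U fun z => f z j) :
    HasPiecewiseFDerivOn volume f (fun x => Matrix.toEuclideanCLM (𝕜 := ℝ) (acDeriv f x)) U := by
  choose ν hν using fun j => (hBV j).2
  let σ : Measure (EuclideanSpace ℝ (Fin n)) := ∑ j, ∑ i, (ν j i).totalVariation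
  have hσ (j i : Fin n) : (ν j i).totalVariation ≤ σ :=
    (Finset.single_le_sum (f := fun i => (ν j i).totalVariation) (fun _ _ => Measure.zero_le _)
      (Finset.mem_univ i)).trans
    (Finset.single_le_sum (f := fun j => ∑ i, (ν j i).totalVariation)
      (fun _ _ => Measure.zero_le _) (Finset.mem_univ j))
  obtain ⟨N, hN, hNm, hN0⟩ := exists_measurable_superset_of_null <| ae_iff.1 <|
    ae_all_iff.2 fun j => ae_all_iff.2 fun i => ae_exists_hasDensityAt_signedIntegral volume (ν j i)
  refine ⟨Set.range fun m => (U ∩ densityBoundedSet σ volume m) \ N, Set.countable_range _, ?_, ?_⟩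
  · rintro _ ⟨m, rfl⟩
    refine ⟨(hU.measurableSet.inter (isClosed_densityBoundedSet σ volume m).measurableSet).diff hNm,
      fun x hx => hx.1.1, fun x hx => hasFDerivWithinAt_euclidean.2 fun j => ?_⟩
    refine (hasFDerivWithinAt_densityBoundedSet hU hUb
      ((EuclideanSpace.proj (𝕜 := ℝ) j).continuous.comp_continuousOn hf) (hBV j).1 (hν j) (hσ j) m
      hx.1.1 fun i => ?_).mono fun z hz => hz.1.2
    obtain ⟨g, hg⟩ := not_not.1 (fun h => hx.2 (hN h)) j i
    rw [ContinuousLinearMap.comp_apply, PiLp.proj_apply, toEuclideanCLM_single_apply,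
      acDeriv_apply_eq_of_hasDensityAt hU (hν j i) hx.1.1 hg]
    exact hg
  · have hcover : ∀ᵐ x, x ∉ N ∧ ∃ m, x ∈ densityBoundedSet σ volume m :=
      (measure_eq_zero_iff_ae_notMem.1 hN0).and (ae_exists_mem_densityBoundedSet σ volume)
    refine measure_mono_null (fun x hx => ?_) (ae_iff.1 hcover)
    rintro ⟨hxN, m, hm⟩
    exact hx.2 ⟨_, ⟨m, rfl⟩, ⟨hx.1, hm⟩, hxN⟩

theorem IsBVLoc.hasPiecewiseFDerivOn (hBV : IsBVLoc U f) (hf : ContinuousOn f U) :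
    HasPiecewiseFDerivOn volume f (fun x => Matrix.toEuclideanCLM (𝕜 := ℝ) (acDeriv f x)) U := by
  refine hasPiecewiseFDerivOn_of_forall_mem_isOpen fun x hx => ?_
  obtain ⟨c, r, hxB, hBU, hB⟩ := hBV x hx
  exact ⟨_, Metric.isOpen_ball, hxB, hBU, hasPiecewiseFDerivOn_of_forall_isBV Metric.isOpen_ball
    Metric.isBounded_ball (hf.mono hBU) hB⟩

theorem HasPiecewiseFDerivOn.aemeasurable_matrixNorm_acDeriv
    (hf : HasPiecewiseFDerivOn volume f
      (fun x => Matrix.toEuclideanCLM (𝕜 := ℝ) (acDeriv f x)) U) :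
    AEMeasurable (fun x => matrixNorm (acDeriv f x)) (volume.restrict U) := by
  simp only [matrixNorm, ← toEuclideanCLM_single_apply]
  have hcont : Continuous fun T : EuclideanSpace ℝ (Fin n) →L[ℝ] EuclideanSpace ℝ (Fin n) =>
      √(∑ j, ∑ i, T (EuclideanSpace.single i 1) j ^ 2) := by fun_prop
  exact hcont.measurable.comp_aemeasurable hf.aemeasurable

end BVDifferentiability

theorem mainTheorem3 {n : ℕ} (Ω₁ Ω₂ : Set (EuclideanSpace ℝ (Fin n)))
    (f : OpenPartialHomeomorph (EuclideanSpace ℝ (Fin n)) (EuclideanSpace ℝ (Fin n)))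
    (hsource : f.source = Ω₁) (htarget : f.target = Ω₂) (hf : IsBVLoc Ω₁ f)
    (q : ℝ) (hq : 1 ≤ q) :
    (∃ K : EuclideanSpace ℝ (Fin n) → ℝ, (∀ y, 0 ≤ K y) ∧
        MemLp K (ENNReal.conjExponent (ENNReal.ofReal q)) (volume.restrict Ω₂) ∧
        ∀ A : Set (EuclideanSpace ℝ (Fin n)), MeasurableSet A → A ⊆ Ω₂ →
          ∫⁻ x in Ω₁ ∩ f ⁻¹' A, ENNReal.ofReal (matrixNorm (acDeriv f x)) ≤
            ∫⁻ y in A, ENNReal.ofReal (K y)) ↔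
      ∃ L : EuclideanSpace ℝ (Fin n) → ℝ,
        MemLp L (ENNReal.conjExponent (ENNReal.ofReal q)) (volume.restrict Ω₁) ∧
        ∀ᵐ x ∂volume.restrict Ω₁,
          matrixNorm (acDeriv f x) ≤ L x * |acJacobian f x| ^ (1 / q) := by
  subst hsource htarget
  have hpiece := hf.hasPiecewiseFDerivOn f.continuousOn
  have hJ : (fun x => ENNReal.ofReal |acJacobian f x|) =ᵐ[volume.restrict f.source]
      (pullbackMeasure f volume).rnDeriv (volume.restrict f.source) := by
    simpa only [det_toEuclideanCLM, acJacobian] using hpiece.abs_det_ae_eq_rnDeriv_pullbackMeasure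
  have := (ENNReal.HolderConjugate.conjExponent (ENNReal.one_le_ofReal.2 hq)).symm
  exact (exists_memLp_target_iff_exists_memLp_pullbackMeasure f volume volume _ _).trans
    (exists_memLp_withDensity_le_iff hJ hpiece.aemeasurable_matrixNorm_acDeriv
      (zero_lt_one.trans_le hq))
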